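/- \textbf{Setting.} Let $H=(V,E,w)$ be a finite directed graph with vertex weights $w:V\to\mathbb{Q}_{\ge 0}$. Each of $n$ facilities $f_1,\dots,f_n$ chooses a location $s_j\in V$; $\mathbf{s}=(s_1,\dots,s_n)\in V^n$ is a profile. Each vertex $v$ is a client, with shopping range $N(v)=\{v\}\cup\{z : (v,z)\in E\}$, and $N_{\mathbf{s}}(v)=\{f_j : s_j\in N(v)\}$. In the Uniform-$2$-FLG each client splits its weight equally among the facilities in its range, so that the payoff of $f_j$ is $$\ell_j(\mathbf{s})=\sum_{v:\, f_j\in N_{\mathbf{s}}(v)}\frac{w(v)}{|N_{\mathbf{s}}(v)|}.$$ For $\alpha\ge 1$, a profile $\mathbf{s}$ is an $\alpha$-approximate equilibrium if $\ell_j(s_j',s_{-j})\le\alpha\,\ell_j(\mathbf{s})$ for every facility $f_j$ and every $s_j'\in V$. For $\varepsilon>0$, a $(1+\varepsilon)$-best response step replaces $\mathbf{s}$ by $(s_j',s_{-j})$ for some facility $f_j$, where $s_j'$ is a best response of $f_j$ to $s_{-j}$ (it maximizes $\ell_j(\cdot,s_{-j})$ over $V$), $\ell_j(s_j',s_{-j})>\ell_j(\mathbf{s})$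 and $\ell_j(s_j',s_{-j})\ge(1+\varepsilon)\,\ell_j(\mathbf{s})$. \textbf{Theorem.} \begin{enumerate} \item Rosenthal's function $\Phi(\mathbf{s})=\sum_{v\in V}\sum_{i=1}^{|N_{\mathbf{s}}(v)|}\frac{w(v)}{i}$ is an exact potential: $\Phi(s_j',s_{-j})-\Phi(\mathbf{s})=\ell_j(s_j',s_{-j})-\ell_j(\mathbf{s})$ for all $\mathbf{s}$, $f_j$ and $s_j'\in V$. \item There is an absolute constant $C>0$ such that, for every instance and every $\varepsilon>0$, every sequence of $(1+\varepsilon)$-best response steps has length at most $C\cdot\max\{1,\tfrac1\varepsilon\}\cdot n^2\log(n+1)$, which is $\mathcal{O}(\frac1\varepsilon n^2\log n)$ for $\varepsilon\le 1$ and $n\ge 2$. A sequence that cannot be continued ends in a $(1+\varepsilon)$-approximate equilibrium. \item There is an FPTAS for computing a $(1+\varepsilon)$-approximate equilibrium: a single algorithm (a random access machine program with logarithmic cost) that, given $H$ with $V\neq\emptyset$, the $n$ facilities and a rational $\varepsilon>0$, outputs a $(1+\varepsilon)$-approximate equilibrium in time polynomial in the size of the input and in $1/\varepsilon$. Here the weights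 and $\varepsilon$ are encoded in binary and the facilities are listed one by one. \end{enumerate} -/

import Mathlib

/-! ## The Uniform-2-FLG -/

/-- A vertex-weighted directed host graph. Loops are allowed but play no role, since only closed
neighbourhoods are used. -/
structure HostGraph (V : Type*) extends Digraph V where
  /-- the weight (purchasing power) of the client at a vertex -/
  w : V → ℚ≥0

namespace HostGraph

noncomputable section

variable {V : Type*} (H : HostGraph V) {k : ℕ}

/-- The shopping range of client `v`: its closed out-neighbourhood. -/
def shoppingRange (v : V) : Set V := {z | z = v ∨ H.Adj v z}

open Classical in
/-- The facilities in the shopping range of client `v` under the placement profile `s`. -/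
def facilitiesInRange (s : Fin k → V) (v : V) : Finset (Fin k) :=
  Finset.univ.filter fun j => s j ∈ H.shoppingRange v

open Classical in
/-- The uniform client weight distribution: client `v` splits its weight equally among all
facilities in its shopping range. -/
def uniformDist (s : Fin k → V) (v : V) (j : Fin k) : ℝ :=
  if j ∈ H.facilitiesInRange s v then (H.w v : ℝ) / ((H.facilitiesInRange s v).card : ℝ) else 0

variable [Fintype V]

/-- The load (payoff) of facility `j` in the Uniform-2-FLG. -/
def load (s : Fin k → V) (j : Fin k) : ℝ := ∑ v, H.uniformDist s v j

/-- `s` is an `α`-approximate equilibrium: no facility can improve its payoff by a factor of more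
than `α` by a unilateral change of location. -/
def IsApproxEquilibrium (α : ℝ) (s : Fin k → V) : Prop :=
  ∀ (j : Fin k) (v : V), H.load (Function.update s j v) j ≤ α * H.load s j

/-- `v` is a best response of facility `j` to the locations of the others in `s`. -/
def IsBestResponse (s : Fin k → V) (j : Fin k) (v : V) : Prop :=
  ∀ u : V, H.load (Function.update s j u) j ≤ H.load (Function.update s j v) j

/-- A `(1+ε)`-best response improvement step: some facility moves to a best response, and this
move is improving and increases its payoff by a factor of at least `1+ε`. (Strict improvement only
matters for a facility of payoff zero.) -/
def ApproxBestResponseStep (ε : ℝ) (s s' : Fin k → V) : Prop :=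
  ∃ (j : Fin k) (v : V), s' = Function.update s j v ∧ H.IsBestResponse s j v ∧
    H.load s j < H.load s' j ∧ (1 + ε) * H.load s j ≤ H.load s' j

/-- Rosenthal's potential. -/
def potential (s : Fin k → V) : ℝ :=
  ∑ v, ∑ i ∈ Finset.Icc 1 (H.facilitiesInRange s v).card, (H.w v : ℝ) / (i : ℝ)

end

end HostGraph

/-! ## Random access machine programs with logarithmic cost -/

namespace RAM

/-- The memory: finitely many (per program) random access arrays of natural numbers;
`m a i` is cell `i` of array `a`. -/
abbrev Mem := ℕ → ℕ → ℕ

/-- Arithmetic expressions; `read a i` is the content of cell `i` of array `a`. -/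
inductive Expr where
  | const (c : ℕ)
  | read (a : ℕ) (i : Expr)
  | add (e f : Expr)
  | sub (e f : Expr)
  | mul (e f : Expr)
  | div (e f : Expr)

/-- The value of an expression (`sub` is truncated, `div` is rounded down). -/
def Expr.eval (m : Mem) : Expr → ℕ
  | .const c => c
  | .read a i => m a (i.eval m)
  | .add e f => e.eval m + f.eval m
  | .sub e f => e.eval m - f.eval m
  | .mul e f => e.eval m * f.eval m
  | .div e f => e.eval m / f.eval m

/-- The logarithmic cost of an evaluation: every operation costs one plus the binary lengths of its
operands, and a memory access costs one plus the binary lengths of the address and the content. -/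
def Expr.cost (m : Mem) : Expr → ℕ
  | .const c => 1 + c.size
  | .read a i => i.cost m + (1 + (i.eval m).size + (m a (i.eval m)).size)
  | .add e f => e.cost m + f.cost m + (1 + (e.eval m).size + (f.eval m).size)
  | .sub e f => e.cost m + f.cost m + (1 + (e.eval m).size + (f.eval m).size)
  | .mul e f => e.cost m + f.cost m + (1 + (e.eval m).size + (f.eval m).size)
  | .div e f => e.cost m + f.cost m + (1 + (e.eval m).size + (f.eval m).size)

/-- Programs; `write a i e` stores the value of `e` in cell `i` of array `a`, and a condition holds
if its value is not zero. -/
inductive Prog where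
  | skip
  | write (a : ℕ) (i e : Expr)
  | seq (p q : Prog)
  | ite (c : Expr) (p q : Prog)
  | loop (c : Expr) (p : Prog)

/-- `Runs p m t m'`: started in memory `m`, the program `p` halts in memory `m'` at total
logarithmic cost `t`. -/
inductive Runs : Prog → Mem → ℕ → Mem → Prop where
  | skip (m : Mem) : Runs .skip m 1 m
  | write (m : Mem) (a : ℕ) (i e : Expr) :
      Runs (.write a i e) m
        (i.cost m + e.cost m + (1 + (i.eval m).size + (e.eval m).size))
        (Function.update m a (Function.update (m a) (i.eval m) (e.eval m)))
  | seq {p q : Prog} {m m₁ m₂ : Mem} {t₁ t₂ : ℕ} :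
      Runs p m t₁ m₁ → Runs q m₁ t₂ m₂ → Runs (.seq p q) m (t₁ + t₂) m₂
  | ite_true {c : Expr} {p q : Prog} {m m' : Mem} {t : ℕ} :
      c.eval m ≠ 0 → Runs p m t m' → Runs (.ite c p q) m (c.cost m + 1 + t) m'
  | ite_false {c : Expr} {p q : Prog} {m m' : Mem} {t : ℕ} :
      c.eval m = 0 → Runs q m t m' → Runs (.ite c p q) m (c.cost m + 1 + t) m'
  | loop_done {c : Expr} {p : Prog} {m : Mem} :
      c.eval m = 0 → Runs (.loop c p) m (c.cost m + 1) m
  | loop_step {c : Expr} {p : Prog} {m m₁ m₂ : Mem} {t₁ t₂ : ℕ} :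
      c.eval m ≠ 0 → Runs p m t₁ m₁ → Runs (.loop c p) m₁ t₂ m₂ →
      Runs (.loop c p) m (c.cost m + 1 + t₁ + t₂) m₂

/-- The initial memory: array `0` is the (empty) output array, array `a + 1` holds the `a`-th list
of the input, and all other cells are zero. -/
def initMem (L : List (List ℕ)) : Mem
  | 0, _ => 0
  | a + 1, i => (L.getD a []).getD i 0

/-- The size of an input: the total binary length of its numbers, with one more symbol for each
number and for each list. -/
def inputSize (L : List (List ℕ)) : ℕ :=
  (L.map fun l => (l.map fun x => x.size + 1).sum + 1).sum

/-- A search problem with instances `ι` and an accuracy parameter `ε` has an FPTAS: a single program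
that, for every instance `x` and every rational `ε > 0`, halts with a correct answer in its output
array, in time polynomial in the size of the input and in `1/ε`. -/
def HasFPTAS {ι : Type*} (encode : ι → ℚ≥0 → List (List ℕ))
    (Correct : ι → ℚ≥0 → (ℕ → ℕ) → Prop) : Prop :=
  ∃ (p : Prog) (P : Polynomial ℕ), ∀ (x : ι) (ε : ℚ≥0), 0 < ε →
    ∃ (t : ℕ) (m : Mem), Runs p (initMem (encode x ε)) t m ∧
      t ≤ P.eval (inputSize (encode x ε) + ⌈1 / ε⌉₊) ∧ Correct x ε (m 0)

end RAM

/-! ## The computational problem -/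

/-- An instance of the Uniform-2-FLG: a nonempty host graph and a number of facilities. -/
structure FLGInstance where
  /-- the number of vertices -/
  n : ℕ
  n_pos : 0 < n
  /-- the number of facilities -/
  k : ℕ
  /-- the host graph -/
  H : HostGraph (Fin n)

namespace FLGInstance

open Classical in
/-- The encoding of an instance and of `ε`: the numbers `n`, `k` and the numerator and denominator
of `ε`; one entry for each facility (so that `k` counts in unary); the numerators and the
denominators of the weights; and the adjacency matrix, row by row. -/
noncomputable def encode (I : FLGInstance) (ε : ℚ≥0) : List (List ℕ) :=
  [[I.n, I.k, ε.num, ε.den],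
   List.replicate I.k 1,
   List.ofFn fun v => (I.H.w v).num,
   List.ofFn fun v => (I.H.w v).den,
   List.ofFn fun e : Fin (I.n * I.n) => if I.H.Adj e.divNat e.modNat then 1 else 0]

/-- The first `k` cells of `out` are a `(1+ε)`-approximate equilibrium. -/
def IsCorrectOutput (I : FLGInstance) (ε : ℚ≥0) (out : ℕ → ℕ) : Prop :=
  ∃ s : Fin I.k → Fin I.n, (∀ j : Fin I.k, out j = (s j : ℕ)) ∧
    I.H.IsApproxEquilibrium (1 + (ε : ℝ)) s

end FLGInstance

/-! ### Rosenthal's exact potential -/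

namespace HostGraph

noncomputable section

variable {V : Type*} (H : HostGraph V) {k : ℕ}

/-! Leaving a facility out of the count at a client drops exactly the last term of the harmonic sum
there, which is that facility's share, and what remains does not depend on where the facility
stands. Hence `potential` is exact.

For the number of steps, let `M` be the largest `coverage` of a vertex. Every client is shared by at
most `k` facilities, so a move to a vertex of coverage `M` pays at least `M / k`, and so does a best
response. A step that gains a factor `1 + ε` therefore raises the potential by at least `ε / (1 + ε)
* M / k` (`ApproxBestResponseStep.coverage_le`). Double counting bounds the potential by `harmonic k
* k * M` (`potential_le_harmonic_mul`), so there are at most `(1 + ε) / ε * k ^ 2 * harmonic k`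
steps.

The machine runs a coarser search: with `n` vertices and total weight `W`, it accepts any move that
raises the potential by more than `ε / ((1 + ε) * n * k) * W`. A best response pays at least `W / (n
* k)`, so a profile without such moves is a `(1 + ε)`-approximate equilibrium
(`isApproxEquilibrium_of_gap`); since the potential is at most `k * W`, polynomially many moves are
accepted. Multiplying by `k!` and by all weight denominators makes the divisions in ℕ exact
(`cast_inner`) and keeps lengths polynomial, since `k` counts in unary. `Exec` bounds the cost by a
syntactic weight times the number of executions times the cell length, so only iteration counts and
lengths of stored values have to be followed. -/

theorem mem_facilitiesInRange {s : Fin k → V} {v : V} {j : Fin k} :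
    j ∈ H.facilitiesInRange s v ↔ s j ∈ H.shoppingRange v := by
  simp [facilitiesInRange]

theorem self_mem_shoppingRange (v : V) : v ∈ H.shoppingRange v := Or.inl rfl

theorem card_facilitiesInRange_le (s : Fin k → V) (v : V) :
    (H.facilitiesInRange s v).card ≤ k := by
  simpa using Finset.card_le_univ (H.facilitiesInRange s v)

theorem erase_facilitiesInRange_update (s : Fin k → V) (j : Fin k) (u v : V) :
    (H.facilitiesInRange (Function.update s j u) v).erase j
      = (H.facilitiesInRange s v).erase j := by
  ext i
  by_cases h : i = j <;> simp [h, mem_facilitiesInRange]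

/-- This is the exact potential property at a single client: the last summand has the full count as
denominator and is the share of `j`. -/
theorem sum_harmonic_eq (s : Fin k → V) (j : Fin k) (v : V) :
    ∑ i ∈ Finset.Icc 1 (H.facilitiesInRange s v).card, (H.w v : ℝ) / (i : ℝ)
      = ∑ i ∈ Finset.Icc 1 ((H.facilitiesInRange s v).erase j).card, (H.w v : ℝ) / (i : ℝ)
        + H.uniformDist s v j := by
  by_cases h : j ∈ H.facilitiesInRange s v
  · rw [uniformDist, if_pos h, ← Finset.card_erase_add_one h,
      Finset.sum_Icc_succ_top (Nat.le_add_left 1 _)]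
  · rw [uniformDist, if_neg h, Finset.erase_eq_of_notMem h, add_zero]

theorem uniformDist_nonneg (s : Fin k → V) (v : V) (j : Fin k) : 0 ≤ H.uniformDist s v j := by
  unfold uniformDist
  split_ifs <;> positivity

variable [Fintype V]

theorem load_nonneg (s : Fin k → V) (j : Fin k) : 0 ≤ H.load s j :=
  Finset.sum_nonneg fun v _ => H.uniformDist_nonneg s v j

theorem potential_eq (s : Fin k → V) (j : Fin k) :
    H.potential s = ∑ v, ∑ i ∈ Finset.Icc 1 ((H.facilitiesInRange s v).erase j).card,
      (H.w v : ℝ) / (i : ℝ) + H.load s j := by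
  rw [potential, load, ← Finset.sum_add_distrib]
  exact Finset.sum_congr rfl fun v _ => H.sum_harmonic_eq s j v

/-- Rosenthal's function is an exact potential. -/
theorem potential_update_sub (s : Fin k → V) (j : Fin k) (v : V) :
    H.potential (Function.update s j v) - H.potential s
      = H.load (Function.update s j v) j - H.load s j := by
  rw [H.potential_eq (Function.update s j v) j, H.potential_eq s j]
  simp only [erase_facilitiesInRange_update]
  ring

theorem potential_nonneg (s : Fin k → V) : 0 ≤ H.potential s :=
  Finset.sum_nonneg fun _ _ => Finset.sum_nonneg fun _ _ => by positivity

/-! ### Coverage and the length of best response sequences -/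

open Classical in
/-- The total weight of the clients that have `u` in their shopping range. -/
def coverage (u : V) : ℝ := ∑ v, if u ∈ H.shoppingRange v then (H.w v : ℝ) else 0

theorem load_le_coverage (s : Fin k → V) (j : Fin k) : H.load s j ≤ H.coverage (s j) := by
  refine Finset.sum_le_sum fun v _ => ?_
  unfold uniformDist
  by_cases h : j ∈ H.facilitiesInRange s v
  · rw [if_pos h, if_pos (H.mem_facilitiesInRange.1 h)]
    refine div_le_self (by positivity) ?_
    exact_mod_cast Finset.card_pos.2 ⟨j, h⟩
  · rw [if_neg h, if_neg fun h' => h (H.mem_facilitiesInRange.2 h')]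

/-- A client in range of `s j` is shared by at most `k` facilities, so `j` receives at least the
fraction `1 / k` of its weight. -/
theorem coverage_le_mul_load (s : Fin k → V) (j : Fin k) :
    H.coverage (s j) ≤ k * H.load s j := by
  rw [load, Finset.mul_sum]
  refine Finset.sum_le_sum fun v _ => ?_
  unfold uniformDist
  by_cases h : j ∈ H.facilitiesInRange s v
  · rw [if_pos h, if_pos (H.mem_facilitiesInRange.1 h)]
    have h1 : (0 : ℝ) < (H.facilitiesInRange s v).card := by
      exact_mod_cast Finset.card_pos.2 ⟨j, h⟩
    have h2 : ((H.facilitiesInRange s v).card : ℝ) ≤ k := by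
      exact_mod_cast H.card_facilitiesInRange_le s v
    have h3 : (0 : ℝ) ≤ H.w v := by positivity
    rw [mul_div_assoc', le_div_iff₀ h1, mul_comm]
    exact mul_le_mul_of_nonneg_right h2 h3
  · rw [if_neg h, if_neg fun h' => h (H.mem_facilitiesInRange.2 h'), mul_zero]

/-- Double counting of the pairs of a client and a facility in its range. -/
theorem sum_card_mul_eq_sum_coverage (s : Fin k → V) :
    ∑ v, ((H.facilitiesInRange s v).card : ℝ) * H.w v = ∑ j, H.coverage (s j) := by
  classical
  simp only [coverage]
  rw [Finset.sum_comm]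
  refine Finset.sum_congr rfl fun v _ => ?_
  rw [← Finset.sum_filter, Finset.sum_const, nsmul_eq_mul]
  congr 3

theorem sum_div_eq_mul_harmonic (x : ℝ) (c : ℕ) :
    ∑ i ∈ Finset.Icc 1 c, x / (i : ℝ) = x * (harmonic c : ℝ) := by
  rw [harmonic_eq_sum_Icc, Rat.cast_sum, Finset.mul_sum]
  simp [div_eq_mul_inv]

/-- A client with `c ≥ 1` facilities in range contributes at most `harmonic k * w ≤ harmonic k * (c
* w)`, and one with `c = 0` contributes nothing. The sum of the `c * w` is a sum of `k` coverages.
-/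
theorem potential_le_harmonic_mul {M : ℝ} (hM : ∀ u, H.coverage u ≤ M) (s : Fin k → V) :
    H.potential s ≤ harmonic k * (k * M) := by
  have h1 : H.potential s ≤
      ∑ v, (harmonic k : ℝ) * (((H.facilitiesInRange s v).card : ℝ) * H.w v) := by
    refine Finset.sum_le_sum fun v _ => ?_
    rcases Nat.eq_zero_or_pos (H.facilitiesInRange s v).card with h | h
    · simp [h]
    · have hw : (0 : ℝ) ≤ H.w v := by positivity
      have hc : (1 : ℝ) ≤ (H.facilitiesInRange s v).card := by exact_mod_cast h
      have hk : (0 : ℝ) ≤ harmonic k := by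
        rw [harmonic_eq_sum_Icc]; push_cast; positivity
      calc _ ≤ ∑ i ∈ Finset.Icc 1 k, (H.w v : ℝ) / (i : ℝ) :=
            Finset.sum_le_sum_of_subset_of_nonneg
              (Finset.Icc_subset_Icc_right (H.card_facilitiesInRange_le s v))
              fun _ _ _ => by positivity
        _ = harmonic k * (1 * H.w v) := by rw [sum_div_eq_mul_harmonic]; ring
        _ ≤ _ := by gcongr
  rw [← Finset.mul_sum, sum_card_mul_eq_sum_coverage] at h1
  refine h1.trans (mul_le_mul_of_nonneg_left ?_ ?_)
  · simpa using Finset.sum_le_sum fun j (_ : j ∈ Finset.univ) => hM (s j)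
  · rw [harmonic_eq_sum_Icc]; push_cast; positivity

/-- The summand `1` in `1 + log k` is absorbed by `1 ≤ 2 * log 2 ≤ 2 * log (k + 1)`. -/
theorem harmonic_le_mul_log (k : ℕ) (hk : 0 < k) :
    (harmonic k : ℝ) ≤ 3 * Real.log ((k : ℝ) + 1) := by
  have h0 : (1 : ℝ) ≤ k := by exact_mod_cast hk
  have h1 := harmonic_le_one_add_log k
  have h2 : Real.log k ≤ Real.log ((k : ℝ) + 1) := Real.log_le_log (by linarith) (by linarith)
  have h3 : Real.log 2 ≤ Real.log ((k : ℝ) + 1) := Real.log_le_log (by norm_num) (by linarith)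
  have h4 := Real.log_two_gt_d9
  linarith

/-- A `(1+ε)`-best response step increases the potential by a fixed fraction of any coverage. -/
theorem ApproxBestResponseStep.coverage_le {ε : ℝ} (hε : 0 < ε) {s s' : Fin k → V}
    (h : H.ApproxBestResponseStep ε s s') (u : V) :
    ε * H.coverage u ≤ (1 + ε) * (k * (H.potential s' - H.potential s)) := by
  obtain ⟨j, v, rfl, hbr, -, h⟩ := h
  rw [potential_update_sub]
  have h1 := H.coverage_le_mul_load (Function.update s j u) j
  rw [Function.update_self] at h1
  have h2 : (k : ℝ) * H.load (Function.update s j u) j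
      ≤ k * H.load (Function.update s j v) j :=
    mul_le_mul_of_nonneg_left (hbr u) (Nat.cast_nonneg k)
  -- The old load is at most the fraction `1 / (1 + ε)` of the new one, so the gain is at least the
  -- fraction `ε / (1 + ε)` of the new load.
  have h3 : ε * H.load (Function.update s j v) j
      ≤ (1 + ε) * (H.load (Function.update s j v) j - H.load s j) := by linarith
  have h4 := mul_le_mul_of_nonneg_left h3 (Nat.cast_nonneg (α := ℝ) k)
  have h5 := mul_le_mul_of_nonneg_left (h1.trans h2) hε.le
  linarith

theorem length_le_of_forall_step {ε : ℝ} (hε : 0 < ε) (T : ℕ) (s : ℕ → Fin k → V)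
    (hs : ∀ t < T, H.ApproxBestResponseStep ε (s t) (s (t + 1))) :
    (T : ℝ) ≤ 6 * (max 1 (1 / ε) * (k : ℝ) ^ 2 * Real.log ((k : ℝ) + 1)) := by
  have hlog : 0 ≤ Real.log ((k : ℝ) + 1) :=
    Real.log_nonneg (by linarith [Nat.cast_nonneg (α := ℝ) k])
  have hmax : (0 : ℝ) ≤ max 1 (1 / ε) := le_max_of_le_left zero_le_one
  rcases Nat.eq_zero_or_pos T with rfl | hT
  · simp only [Nat.cast_zero]; positivity
  -- The first step supplies a facility and a vertex; its strict improvement makes the maximal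
  -- coverage positive, so that it can be cancelled at the end.
  obtain ⟨j₀, v₀, hs₀, -, hlt, -⟩ := hs 0 hT
  have hk : 0 < k := j₀.pos
  have : Nonempty V := ⟨v₀⟩
  obtain ⟨u, hu⟩ := Finite.exists_max H.coverage
  have hM : 0 < H.coverage u :=
    ((H.load_nonneg _ _).trans_lt hlt).trans_le ((H.load_le_coverage _ _).trans (hu _))
  have hsum : ∀ t ≤ T, (t : ℝ) * (ε * H.coverage u)
      ≤ (1 + ε) * (k * (H.potential (s t) - H.potential (s 0))) := by
    intro t
    induction t with
    | zero => simp
    | succ t ih =>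
      intro ht
      have h1 := ih (by omega)
      have h2 := ApproxBestResponseStep.coverage_le H hε (hs t (by omega)) u
      push_cast
      linarith
  have h1 := hsum T le_rfl
  have h2 : H.potential (s T) - H.potential (s 0)
      ≤ 3 * Real.log ((k : ℝ) + 1) * (k * H.coverage u) := by
    have := H.potential_le_harmonic_mul hu (s T)
    have h3 : (harmonic k : ℝ) * (k * H.coverage u)
        ≤ 3 * Real.log ((k : ℝ) + 1) * (k * H.coverage u) :=
      mul_le_mul_of_nonneg_right (harmonic_le_mul_log k hk) (by positivity)
    linarith [H.potential_nonneg (s 0)]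
  have h3 : (T : ℝ) * (ε * H.coverage u)
      ≤ (1 + ε) * (k * (3 * Real.log ((k : ℝ) + 1) * (k * H.coverage u))) :=
    h1.trans (by gcongr)
  -- That is, `(1 + ε) / ε = 1 + 1 / ε ≤ 2 * max 1 (1 / ε)`; this `2` and the `3` from the harmonic
  -- bound give the constant `6`.
  have h4 : 1 + ε ≤ 2 * max 1 (1 / ε) * ε := by
    have h5 := mul_le_mul_of_nonneg_right (le_max_left 1 (1 / ε)) hε.le
    have h6 := mul_le_mul_of_nonneg_right (le_max_right 1 (1 / ε)) hε.le
    rw [one_div_mul_cancel hε.ne'] at h6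
    linarith
  have h5 := mul_le_mul_of_nonneg_right h4
    (show 0 ≤ k * (3 * Real.log ((k : ℝ) + 1) * (k * H.coverage u)) by positivity)
  refine le_of_mul_le_mul_right ?_ (mul_pos hε hM)
  calc _ ≤ _ := h3.trans h5
    _ = _ := by ring

/-! ### Approximate equilibria from the absence of large gains -/

theorem isApproxEquilibrium_of_not_step {ε : ℝ} (hε : 0 < ε) {s : Fin k → V}
    (h : ¬ ∃ s' : Fin k → V, H.ApproxBestResponseStep ε s s') :
    H.IsApproxEquilibrium (1 + ε) s := by
  intro j v
  by_contra! hv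
  have : Nonempty V := ⟨v⟩
  obtain ⟨u, hu⟩ := Finite.exists_max fun u => H.load (Function.update s j u) j
  have h1 := hv.trans_le (hu v)
  -- Loads are nonnegative, so beating the factor `1 + ε` is also a strict improvement, as a step
  -- requires.
  have h2 : H.load s j ≤ (1 + ε) * H.load s j := by
    nlinarith [mul_nonneg hε.le (H.load_nonneg s j)]
  exact h ⟨_, j, u, rfl, hu, h2.trans_lt h1, h1.le⟩

/-- A profile in which no deviation raises the potential by more than the fraction
`ε / ((1 + ε) * |V| * k)` of the total weight is a `(1+ε)`-approximate equilibrium. -/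
theorem isApproxEquilibrium_of_gap {ε : ℝ} (hε : 0 < ε) {s : Fin k → V}
    (h : ∀ j v, Fintype.card V * k * (1 + ε) *
      (H.potential (Function.update s j v) - H.potential s) ≤ ε * ∑ v, (H.w v : ℝ)) :
    H.IsApproxEquilibrium (1 + ε) s := by
  intro j v
  have : Nonempty V := ⟨v⟩
  have hn : (0 : ℝ) < Fintype.card V := by exact_mod_cast Fintype.card_pos
  have hk : (0 : ℝ) < k := by exact_mod_cast j.pos
  obtain ⟨u, hu⟩ := Finite.exists_max fun u => H.load (Function.update s j u) j
  -- Facility `j` could move onto client `v` itself and earn at least `w v / k` there, so a best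
  -- response earns at least that for every `v`.
  have h1 : ∑ v, (H.w v : ℝ) ≤ Fintype.card V * (k * H.load (Function.update s j u) j) := by
    have h2 : ∀ v, (H.w v : ℝ) ≤ k * H.load (Function.update s j u) j := by
      intro v
      have h3 := H.coverage_le_mul_load (Function.update s j v) j
      rw [Function.update_self] at h3
      have h4 : (H.w v : ℝ) ≤ H.coverage v := by
        classical
        have := Finset.single_le_sum
          (f := fun z => if v ∈ H.shoppingRange z then (H.w z : ℝ) else 0)
          (fun z _ => by split_ifs <;> positivity) (Finset.mem_univ v)
        simp only [if_pos (H.self_mem_shoppingRange v)] at this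
        exact this.trans (le_of_eq (Finset.sum_congr rfl fun _ _ => by congr))
      exact h4.trans (h3.trans (mul_le_mul_of_nonneg_left (hu v) hk.le))
    simpa using Finset.sum_le_sum fun v (_ : v ∈ Finset.univ) => h2 v
  have h2 := (h j u).trans (mul_le_mul_of_nonneg_left h1 hε.le)
  rw [potential_update_sub] at h2
  refine (hu v).trans (le_of_mul_le_mul_left ?_ (mul_pos hn hk))
  linarith

end

end HostGraph

/-! ## Cost analysis of random access machine programs -/

/-- Holds because `a + 1 ≤ 2 ^ a.size`. Sums and products both lie below `(a + 1) * (b + 1)`, so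
lengths are subadditive under either operation. -/
theorem Nat.size_le_of_lt_mul {a b c : ℕ} (h : c < (a + 1) * (b + 1)) :
    c.size ≤ a.size + b.size := by
  rw [Nat.size_le, pow_add]
  exact h.trans_le (Nat.mul_le_mul (Nat.lt_size_self a) (Nat.lt_size_self b))

theorem Nat.size_add_le (a b : ℕ) : (a + b).size ≤ a.size + b.size :=
  Nat.size_le_of_lt_mul (by nlinarith)

theorem Nat.size_mul_le (a b : ℕ) : (a * b).size ≤ a.size + b.size :=
  Nat.size_le_of_lt_mul (by nlinarith)

namespace RAM

variable {S N : ℕ} {m : Mem}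

/-- All cells hold numbers of binary length at most `S`. -/
def Bounded (S : ℕ) (m : Mem) : Prop := ∀ a i, (m a i).size ≤ S

/-- Factor by which the value of an expression may be longer than the memory cells. -/
def Expr.growth : Expr → ℕ
  | .const c => c.size
  | .read _ _ => 1
  | .add e f => e.growth + f.growth
  | .sub e f => e.growth + f.growth
  | .mul e f => e.growth + f.growth
  | .div e f => e.growth + f.growth

/-- Factor by which the cost of an expression may exceed the length of the memory cells. -/
def Expr.weight : Expr → ℕ
  | .const c => 1 + c.size
  | .read _ i => i.weight + (2 + i.growth)
  | .add e f => e.weight + f.weight + (1 + e.growth + f.growth)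
  | .sub e f => e.weight + f.weight + (1 + e.growth + f.growth)
  | .mul e f => e.weight + f.weight + (1 + e.growth + f.growth)
  | .div e f => e.weight + f.weight + (1 + e.growth + f.growth)

theorem Expr.size_eval_le (hm : Bounded S m) (e : Expr) :
    (e.eval m).size ≤ e.growth * (S + 1) := by
  induction e with
  | const c => exact Nat.le_mul_of_pos_right _ (Nat.succ_pos _)
  | read a i _ => exact (hm _ _).trans (by simp [growth])
  | add e f he hf =>
    exact (Nat.size_add_le _ _).trans (by rw [growth, add_mul]; exact add_le_add he hf)
  | sub e f he hf =>
    exact (Nat.size_le_size (Nat.sub_le _ _)).trans (he.trans (by rw [growth, add_mul]; omega))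
  | mul e f he hf =>
    exact (Nat.size_mul_le _ _).trans (by rw [growth, add_mul]; exact add_le_add he hf)
  | div e f he hf =>
    exact (Nat.size_le_size (Nat.div_le_self _ _)).trans
      (he.trans (by rw [growth, add_mul]; omega))

theorem Expr.cost_le (hm : Bounded S m) (e : Expr) : e.cost m ≤ e.weight * (S + 1) := by
  induction e with
  | const c => exact Nat.le_mul_of_pos_right _ (Nat.succ_pos _)
  | read a i hi =>
    have h1 := i.size_eval_le hm
    have h2 := hm a (i.eval m)
    simp only [cost, weight]
    nlinarith
  | add e f he hf | sub e f he hf | mul e f he hf | div e f he hf =>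
    have h1 := e.size_eval_le hm
    have h2 := f.size_eval_le hm
    simp only [cost, weight]
    nlinarith

/-- The weight of the expressions in a program. -/
def Prog.weight : Prog → ℕ
  | .skip => 1
  | .write _ i e => i.weight + e.weight + (1 + i.growth + e.growth)
  | .seq p q => p.weight + q.weight
  | .ite c p q => c.weight + 1 + (p.weight + q.weight)
  | .loop c p => c.weight + 1 + p.weight

/-- Started in `m`, the program `p` halts in a memory with cells of length at most `S` that
satisfies `Q`, and no part of `p` is executed more than `N` times. -/
def Exec (S N : ℕ) (p : Prog) (m : Mem) (Q : Mem → Prop) : Prop :=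
  ∃ t m', Runs p m t m' ∧ t ≤ p.weight * N * (S + 1) ∧ Bounded S m' ∧ Q m'

theorem Exec.mono {p : Prog} {Q Q' : Mem → Prop} {N' : ℕ} (h : Exec S N p m Q) (hN : N ≤ N')
    (hQ : ∀ m', Bounded S m' → Q m' → Q' m') : Exec S N' p m Q' := by
  obtain ⟨t, m', h1, h2, h3, h4⟩ := h
  exact ⟨t, m', h1, h2.trans (by gcongr), h3, hQ m' h3 h4⟩

theorem Exec.skip {Q : Mem → Prop} (hm : Bounded S m) (hN : 0 < N) (hQ : Q m) :
    Exec S N .skip m Q :=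
  ⟨1, m, .skip m, by rw [Prog.weight]; nlinarith, hm, hQ⟩

theorem Exec.write {Q : Mem → Prop} {a : ℕ} {i e : Expr} (hm : Bounded S m) (hN : 0 < N)
    (he : (e.eval m).size ≤ S)
    (hQ : Q (Function.update m a (Function.update (m a) (i.eval m) (e.eval m)))) :
    Exec S N (.write a i e) m Q := by
  refine ⟨_, _, .write m a i e, ?_, ?_, hQ⟩
  · have h1 := i.size_eval_le hm
    have h2 := e.size_eval_le hm
    have h3 := i.cost_le hm
    have h4 := e.cost_le hm
    rw [Prog.weight, mul_right_comm]
    refine le_trans ?_ (Nat.le_mul_of_pos_right _ hN)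
    nlinarith
  · intro b x
    by_cases hb : b = a
    · subst hb
      by_cases hx : x = i.eval m
      · simpa [hx] using he
      · simpa [hx] using hm b x
    · simpa [hb] using hm b x

/-- The execution of `q` is nested in the postcondition of `p`, so a straight-line program is
verified by one nested term; the weights add and `N` stays. -/
theorem Exec.seq {p q : Prog} {Q : Mem → Prop}
    (h : Exec S N p m fun m' => Bounded S m' → Exec S N q m' Q) : Exec S N (.seq p q) m Q := by
  obtain ⟨t, m', h1, h2, h3, h4⟩ := h
  obtain ⟨t', m'', h5, h6, h7, h8⟩ := h4 h3
  refine ⟨_, _, .seq h1 h5, ?_, h7, h8⟩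
  rw [Prog.weight]
  nlinarith

theorem Exec.ite {c : Expr} {p q : Prog} {Q : Mem → Prop} (hm : Bounded S m) (hN : 0 < N)
    (hp : c.eval m ≠ 0 → Exec S N p m Q) (hq : c.eval m = 0 → Exec S N q m Q) :
    Exec S N (.ite c p q) m Q := by
  have h0 := c.cost_le hm
  have h1 : c.cost m + 1 ≤ (c.weight + 1) * N * (S + 1) := by
    rw [mul_right_comm]
    refine le_trans ?_ (Nat.le_mul_of_pos_right _ hN)
    nlinarith
  by_cases hc : c.eval m = 0
  · obtain ⟨t, m', h2, h3, h4⟩ := hq hc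
    refine ⟨_, m', .ite_false hc h2, ?_, h4⟩
    have : 0 ≤ p.weight * N * (S + 1) := Nat.zero_le _
    rw [Prog.weight]
    nlinarith
  · obtain ⟨t, m', h2, h3, h4⟩ := hp hc
    refine ⟨_, m', .ite_true hc h2, ?_, h4⟩
    have : 0 ≤ q.weight * N * (S + 1) := Nat.zero_le _
    rw [Prog.weight]
    nlinarith

/-- Loops with an invariant and a decreasing measure. -/
theorem Exec.loop {c : Expr} {p : Prog} (Inv : Mem → Prop) (μ : Mem → ℕ) (hN : 0 < N)
    (hstep : ∀ m, Bounded S m → Inv m → c.eval m ≠ 0 →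
      Exec S N p m fun m' => Inv m' ∧ μ m' < μ m)
    (r : ℕ) (hm : Bounded S m) (hInv : Inv m) (hμ : μ m ≤ r) :
    Exec S ((r + 1) * N) (.loop c p) m fun m' => Inv m' ∧ c.eval m' = 0 := by
  have h1 : ∀ m, Bounded S m → c.cost m + 1 ≤ (c.weight + 1) * N * (S + 1) := by
    intro m hm
    have h0 := c.cost_le hm
    rw [mul_right_comm]
    refine le_trans ?_ (Nat.le_mul_of_pos_right _ hN)
    nlinarith
  induction r generalizing m with
  | zero =>
    by_cases hc : c.eval m = 0
    · refine ⟨_, m, .loop_done hc, ?_, hm, hInv, hc⟩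
      refine (h1 m hm).trans ?_
      rw [Prog.weight, zero_add, one_mul]
      gcongr ?_ * _ * _
      exact Nat.le_add_right _ _
    -- At measure zero another iteration would have to decrease the measure further.
    · obtain ⟨-, m', -, -, -, -, h2⟩ := hstep m hm hInv hc
      omega
  | succ r ih =>
    by_cases hc : c.eval m = 0
    · refine ⟨_, m, .loop_done hc, ?_, hm, hInv, hc⟩
      refine (h1 m hm).trans ?_
      rw [Prog.weight]
      gcongr ?_ * ?_ * _
      · exact Nat.le_add_right _ _
      · nlinarith
    · obtain ⟨t, m', h2, h3, h4, h5, h6⟩ := hstep m hm hInv hc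
      obtain ⟨t', m'', h7, h8, h9⟩ := ih h4 h5 (by omega)
      refine ⟨_, m'', .loop_step hc h2 h7, ?_, h9⟩
      have h10 := h1 m hm
      rw [Prog.weight] at h8 ⊢
      calc _ ≤ (c.weight + 1) * N * (S + 1) + p.weight * N * (S + 1)
            + (c.weight + 1 + p.weight) * ((r + 1) * N) * (S + 1) := by omega
        _ = _ := by ring

end RAM

/-! ## Local search for the Uniform-2-FLG as a random access machine program -/

/-! ### Evaluation of the scaled potential -/

namespace FLGProgram

open RAM

/-- The numbers that the computation of the potential reads. -/
structure Data where
  /-- the number of vertices -/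
  n : ℕ
  /-- the number of facilities -/
  k : ℕ
  /-- the common denominator -/
  D : ℕ
  /-- the numerators of the weights -/
  num : ℕ → ℕ
  /-- the denominators of the weights -/
  den : ℕ → ℕ
  /-- the adjacency matrix -/
  adj : ℕ → ℕ

namespace Data

variable (d : Data)

/-- Nonzero if and only if `z` is in the shopping range of `v`. -/
def test (v z : ℕ) : ℕ := d.adj (v * d.n + z) + (1 - ((z - v) + (v - z)))

/-- The number of facilities `j < i` in the shopping range of `v`. -/
def count (s : ℕ → ℕ) (v i : ℕ) : ℕ := ∑ j ∈ Finset.range i, if d.test v (s j) ≠ 0 then 1 else 0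

/-- The contribution of the client `v` to the scaled potential of the first `i` facilities. -/
def inner (s : ℕ → ℕ) (v i : ℕ) : ℕ :=
  ∑ c ∈ Finset.range (d.count s v i), d.num v * d.D / d.den v / (c + 1)

/-- The scaled potential. -/
def phi (s : ℕ → ℕ) : ℕ := ∑ v ∈ Finset.range d.n, d.inner s v d.k

theorem count_le (s : ℕ → ℕ) (v i : ℕ) : d.count s v i ≤ i := by
  unfold count
  refine (Finset.sum_le_card_nsmul _ _ 1 fun j _ => ?_).trans (by simp)
  split_ifs <;> simp

theorem count_mono (s : ℕ → ℕ) (v : ℕ) {i j : ℕ} (h : i ≤ j) :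
    d.count s v i ≤ d.count s v j :=
  Finset.sum_le_sum_of_subset (Finset.range_mono h)

theorem count_succ (s : ℕ → ℕ) (v i : ℕ) :
    d.count s v (i + 1) = d.count s v i + if d.test v (s i) ≠ 0 then 1 else 0 :=
  Finset.sum_range_succ _ _

theorem inner_mono (s : ℕ → ℕ) (v : ℕ) {i j : ℕ} (h : i ≤ j) :
    d.inner s v i ≤ d.inner s v j :=
  Finset.sum_le_sum_of_subset (Finset.range_mono (d.count_mono s v h))

theorem inner_zero (s : ℕ → ℕ) (v : ℕ) : d.inner s v 0 = 0 := by simp [inner, count]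

/-- The left side is the accumulator in the middle of the computation, so a length bound for the
final potential covers all intermediate values. -/
theorem sum_inner_add_inner_le_phi (s : ℕ → ℕ) {v i : ℕ} (hv : v < d.n) (hi : i ≤ d.k) :
    ∑ u ∈ Finset.range v, d.inner s u d.k + d.inner s v i ≤ d.phi s :=
  calc _ ≤ ∑ u ∈ Finset.range v, d.inner s u d.k + d.inner s v d.k := by
        gcongr
        exact d.inner_mono s v hi
    _ = ∑ u ∈ Finset.range (v + 1), d.inner s u d.k := (Finset.sum_range_succ _ _).symm
    _ ≤ _ := Finset.sum_le_sum_of_subset (Finset.range_mono hv)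

end Data

/-- The memory holds the data: the numbers of vertices and facilities in array `1`, the weights in
the arrays `3` and `4`, the adjacency matrix in array `5`, and the common denominator in
array `6`. -/
structure Matches (d : Data) (m : Mem) : Prop where
  n : m 1 0 = d.n
  k : m 1 1 = d.k
  num : m 3 = d.num
  den : m 4 = d.den
  adj : m 5 = d.adj
  D : m 6 0 = d.D

/-- Array `0` is exempt because the search changes the profile; the arrays from `7` on are working
storage. -/
theorem Matches.congr {d : Data} {m m' : Mem} (h : Matches d m)
    (h' : ∀ a < 7, 0 < a → m' a = m a) : Matches d m' := by
  constructor <;> rw [h' _ (by norm_num) (by norm_num)]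
  exacts [h.n, h.k, h.num, h.den, h.adj, h.D]

/-- The scalar variable that is kept in cell `0` of array `a`. -/
abbrev var (a : ℕ) : Expr := .read a (.const 0)

/-- Assignment to a scalar variable. -/
abbrev assign (a : ℕ) (e : Expr) : Prog := .write a (.const 0) e

/-- The number of vertices. -/
abbrev nE : Expr := .read 1 (.const 0)

/-- The number of facilities. -/
abbrev kE : Expr := .read 1 (.const 1)

/-- Tests whether the facility in variable `12` is in the range of the client in variable `11`. -/
def testE : Expr :=
  .add (.read 5 (.add (.mul (var 11) nE) (.read 0 (var 12))))
    (.sub (.const 1)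
      (.add (.sub (.read 0 (var 12)) (var 11)) (.sub (var 11) (.read 0 (var 12)))))

/-- The loop body over the facilities. -/
def facilityBody : Prog :=
  .seq
    (.ite testE
      (.seq (assign 13 (.add (var 13) (.const 1)))
        (assign 14 (.add (var 14)
          (.div (.div (.mul (.read 3 (var 11)) (var 6)) (.read 4 (var 11))) (var 13)))))
      .skip)
    (assign 12 (.add (var 12) (.const 1)))

/-- Adds the contribution of the client in variable `11` to variable `14`. -/
def facilityLoop : Prog := .loop (.sub kE (var 12)) facilityBody

/-- The loop body over the clients. -/
def clientBody : Prog :=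
  .seq (assign 12 (.const 0)) (.seq (assign 13 (.const 0))
    (.seq facilityLoop (assign 11 (.add (var 11) (.const 1)))))

/-- Computes the scaled potential of the profile in array `0` into variable `14`. -/
def potentialProg : Prog :=
  .seq (assign 14 (.const 0)) (.seq (assign 11 (.const 0)) (.loop (.sub nE (var 11)) clientBody))

/-- The loop invariant of `facilityLoop`. -/
structure FacilityInv (d : Data) (m₀ : Mem) (v : ℕ) (m : Mem) : Prop where
  frame : ∀ a < 11, m a = m₀ a
  client : m 11 0 = v
  index_le : m 12 0 ≤ d.k
  count : m 13 0 = d.count (m₀ 0) v (m 12 0)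
  total : m 14 0 = ∑ u ∈ Finset.range v, d.inner (m₀ 0) u d.k + d.inner (m₀ 0) v (m 12 0)

variable {S : ℕ}

theorem size_le_of_le {x y : ℕ} (h : x ≤ y) (hy : y.size ≤ S) : x.size ≤ S :=
  (Nat.size_le_size h).trans hy

theorem exec_facilityBody {d : Data} {m₀ m : Mem} {v : ℕ} (hd : Matches d m₀)
    (hphi : (d.phi (m₀ 0)).size ≤ S) (hv : v < d.n) (hm : Bounded S m)
    (hInv : FacilityInv d m₀ v m) (hlt : m 12 0 < d.k) :
    Exec S 1 facilityBody m fun m' => FacilityInv d m₀ v m' ∧ m' 12 0 = m 12 0 + 1 := by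
  obtain ⟨hf, h11, -, h13, h14⟩ := hInv
  have e0 := hf 0 (by norm_num)
  have e1 := hf 1 (by norm_num)
  have e3 := hf 3 (by norm_num)
  have e4 := hf 4 (by norm_num)
  have e5 := hf 5 (by norm_num)
  have e6 := hf 6 (by norm_num)
  have hk : d.k.size ≤ S := by rw [← hd.k, ← e1]; exact hm _ _
  have htest : testE.eval m = d.test v (m₀ 0 (m 12 0)) := by
    simp [testE, Expr.eval, Data.test, h11, e0, e1, e5, hd.n, hd.adj]
  have hcount := d.count_succ (m₀ 0) v (m 12 0)
  have hcle := (d.count_mono (m₀ 0) v (Nat.succ_le_of_lt hlt)).trans (d.count_le _ _ _)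
  have htot := d.sum_inner_add_inner_le_phi (m₀ 0) hv (Nat.succ_le_of_lt hlt)
  refine .seq (.ite hm one_pos (fun hc => ?_) (fun hc => ?_))
  · rw [htest] at hc
    rw [if_pos hc] at hcount
    -- Variable `13` is incremented before the division, so the divisor is the old count plus one.
    have hin : d.inner (m₀ 0) v (m 12 0 + 1) = d.inner (m₀ 0) v (m 12 0)
        + d.num v * d.D / d.den v / (d.count (m₀ 0) v (m 12 0) + 1) := by
      rw [Data.inner, hcount, Finset.sum_range_succ, Data.inner]
    rw [Nat.succ_eq_add_one, hcount] at hcle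
    rw [Nat.succ_eq_add_one, hin] at htot
    refine .seq (.write hm one_pos ?_ fun hm₁ => .write hm₁ one_pos ?_ fun hm₂ =>
      .write hm₂ one_pos ?_ ⟨⟨?_, ?_, ?_, ?_, ?_⟩, ?_⟩)
    · simp only [Expr.eval, h13]
      exact size_le_of_le hcle hk
    · simp [Expr.eval, h11, h13, h14, e3, e4, e6, hd.num, hd.den, hd.D]
      exact size_le_of_le (by omega) hphi
    · simp only [Expr.eval]
      exact size_le_of_le hlt hk
    · intro a ha
      simp [(ha.trans (by norm_num : 11 < 12)).ne, (ha.trans (by norm_num : 11 < 13)).ne,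
        (ha.trans (by norm_num : 11 < 14)).ne, hf a ha]
    · simpa using h11
    · simpa [Expr.eval] using hlt
    · simp [Expr.eval, hcount, h13]
    · simp [Expr.eval, hin, h11, h13, h14, e3, e4, e6, hd.num, hd.den, hd.D,
        add_assoc]
    · simp [Expr.eval]
  · rw [htest] at hc
    rw [if_neg (not_not.2 hc), add_zero] at hcount
    have hin : d.inner (m₀ 0) v (m 12 0 + 1) = d.inner (m₀ 0) v (m 12 0) := by
      rw [Data.inner, hcount, Data.inner]
    refine .skip hm one_pos fun hm₁ => .write hm₁ one_pos ?_ ⟨⟨?_, ?_, ?_, ?_, ?_⟩, ?_⟩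
    · simp only [Expr.eval]
      exact size_le_of_le hlt hk
    · intro a ha
      simp [(ha.trans (by norm_num : 11 < 12)).ne, hf a ha]
    · simpa using h11
    · simpa [Expr.eval] using hlt
    · simp [Expr.eval, hcount, h13]
    · simp [Expr.eval, hin, h14]
    · simp [Expr.eval]

theorem exec_facilityLoop {d : Data} {m₀ m : Mem} {v : ℕ} (hd : Matches d m₀)
    (hphi : (d.phi (m₀ 0)).size ≤ S) (hv : v < d.n) (hm : Bounded S m)
    (hInv : FacilityInv d m₀ v m) (h0 : m 12 0 = 0) :
    Exec S (d.k + 1) facilityLoop m fun m' => FacilityInv d m₀ v m' ∧ m' 12 0 = d.k := by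
  have hc : ∀ m, FacilityInv d m₀ v m → (Expr.sub kE (var 12)).eval m = d.k - m 12 0 := by
    intro m h
    simp [Expr.eval, h.frame 1 (by norm_num), hd.k]
  refine (Exec.loop (FacilityInv d m₀ v) (fun m => d.k - m 12 0) one_pos
    (fun m hm hI h => ?_) d.k hm hInv (by omega)).mono (by omega) fun m' _ h => ⟨h.1, ?_⟩
  · rw [hc m hI] at h
    exact (exec_facilityBody hd hphi hv hm hI (by omega)).mono le_rfl
      fun m' _ h => ⟨h.1, by omega⟩
  · have h1 := h.2
    rw [hc m' h.1] at h1
    have := h.1.index_le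
    omega

/-- The loop invariant of the loop over the clients. -/
structure ClientInv (d : Data) (m₀ : Mem) (m : Mem) : Prop where
  frame : ∀ a < 11, m a = m₀ a
  client_le : m 11 0 ≤ d.n
  total : m 14 0 = ∑ u ∈ Finset.range (m 11 0), d.inner (m₀ 0) u d.k

theorem exec_clientBody {d : Data} {m₀ m : Mem} (hd : Matches d m₀)
    (hphi : (d.phi (m₀ 0)).size ≤ S) (hm : Bounded S m)
    (hInv : ClientInv d m₀ m) (hlt : m 11 0 < d.n) :
    Exec S (d.k + 1) clientBody m fun m' => ClientInv d m₀ m' ∧ m' 11 0 = m 11 0 + 1 := by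
  obtain ⟨hf, -, h14⟩ := hInv
  have hn : d.n.size ≤ S := by rw [← hd.n, ← hf 1 (by norm_num)]; exact hm _ _
  refine .seq (.write hm (Nat.succ_pos _) (by simp [Expr.eval]) fun hm₁ => .seq
    (.write hm₁ (Nat.succ_pos _) (by simp [Expr.eval]) fun hm₂ => .seq
    ((exec_facilityLoop (v := m 11 0) hd hphi hlt hm₂ ⟨?_, ?_, ?_, ?_, ?_⟩ ?_).mono le_rfl
    fun m' _ ⟨h, h12⟩ hm₃ => .write hm₃ (Nat.succ_pos _) ?_ ⟨⟨?_, ?_, ?_⟩, ?_⟩)))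
  · intro a ha
    simp [(ha.trans (by norm_num : 11 < 12)).ne,
      (ha.trans (by norm_num : 11 < 13)).ne, hf a ha]
  · simp
  · simp [Expr.eval]
  · simp [Expr.eval, Data.count]
  · simp [Expr.eval, h14, d.inner_zero]
  · simp [Expr.eval]
  · simp only [Expr.eval, h.client]
    exact size_le_of_le hlt hn
  · intro a ha
    simp [ha.ne, h.frame a ha]
  · simpa [Expr.eval, h.client] using hlt
  · simp [Expr.eval, h.client, h.total, Finset.sum_range_succ, h12]
  · simp [Expr.eval, h.client]

theorem exec_potentialProg {d : Data} {m : Mem} (hd : Matches d m)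
    (hphi : (d.phi (m 0)).size ≤ S) (hm : Bounded S m) :
    Exec S ((d.n + 1) * (d.k + 1)) potentialProg m fun m' =>
      (∀ a < 11, m' a = m a) ∧ m' 14 0 = d.phi (m 0) := by
  have hN : 0 < (d.n + 1) * (d.k + 1) := by positivity
  have hc : ∀ m', ClientInv d m m' → (Expr.sub nE (var 11)).eval m' = d.n - m' 11 0 := by
    intro m' h
    simp [Expr.eval, h.frame 1 (by norm_num), hd.n]
  refine .seq (.write hm hN (by simp [Expr.eval]) fun hm₁ => .seq
    (.write hm₁ hN (by simp [Expr.eval]) fun hm₂ =>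
    (Exec.loop (ClientInv d m) (fun m => d.n - m 11 0) (Nat.succ_pos _)
    (fun m' hm' hI h => ?_) d.n hm₂ ⟨?_, ?_, ?_⟩ (Nat.sub_le _ _)).mono le_rfl
    fun m' _ h => ⟨h.1.frame, ?_⟩))
  · rw [hc m' hI] at h
    exact (exec_clientBody hd hphi hm' hI (by omega)).mono le_rfl fun m' _ h => ⟨h.1, by omega⟩
  · intro a ha
    simp [ha.ne, (ha.trans (by norm_num : 11 < 14)).ne]
  · simp [Expr.eval]
  · simp [Expr.eval]
  · have h1 := h.2
    rw [hc m' h.1] at h1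
    have h2 := h.1.client_le
    rw [h.1.total, Data.phi, show m' 11 0 = d.n by omega]

end FLGProgram

/-! ### Local search over single moves -/

namespace FLGProgram

open RAM

variable {S : ℕ}

/-- Moving facility `q / n` to vertex `q % n`. -/
def Data.move (d : Data) (s : ℕ → ℕ) (q : ℕ) : ℕ → ℕ :=
  Function.update s (q / d.n) (q - d.n * (q / d.n))

/-- The move `q` increases the scaled potential substantially, where `a / b` is the accuracy and
`A` the scaled total weight. -/
def Data.Improves (d : Data) (a b A : ℕ) (s : ℕ → ℕ) (q : ℕ) : Prop :=
  d.phi s * (d.n * d.k * (a + b)) + a * A < d.phi (d.move s q) * (d.n * d.k * (a + b))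

/-- An upper bound for the number of improving moves that are still possible. -/
def Data.rounds (d : Data) (a b A : ℕ) (s : ℕ → ℕ) : ℕ :=
  (d.k * A * (d.n * d.k * (a + b)) - d.phi s * (d.n * d.k * (a + b))) / (a * A)

/-- Each improving move consumes more than `a * A` of the distance to the upper bound of the
potential, so the quotient of that distance by `a * A` drops by at least one. -/
theorem Data.Improves.rounds_lt {d : Data} {a b A : ℕ} {s : ℕ → ℕ} {q : ℕ} (ha : 0 < a)
    (hphi : d.phi (d.move s q) ≤ d.k * A) (h : d.Improves a b A s q) :
    d.rounds a b A (d.move s q) < d.rounds a b A s := by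
  unfold Data.Improves at h
  unfold Data.rounds
  have h1 : d.phi (d.move s q) * (d.n * d.k * (a + b)) ≤ d.k * A * (d.n * d.k * (a + b)) :=
    Nat.mul_le_mul_right _ hphi
  generalize d.phi (d.move s q) * (d.n * d.k * (a + b)) = x at *
  generalize d.phi s * (d.n * d.k * (a + b)) = y at *
  -- With `A = 0` the divisor vanishes, but then the potential is bounded by zero and no move
  -- improves.
  rcases Nat.eq_zero_or_pos A with rfl | hA
  · simp only [mul_zero, zero_mul] at h1 h
    omega
  have hpos := Nat.mul_pos ha hA
  generalize d.k * A * (d.n * d.k * (a + b)) = z at *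
  rw [Nat.lt_iff_add_one_le, ← Nat.add_div_right _ hpos]
  exact Nat.div_le_div_right (by omega)

/-- The number of vertices times the number of facilities times the sum of the numerator and the
denominator of the accuracy. -/
def scaleE : Expr := .mul (.mul nE kE) (.add (.read 1 (.const 2)) (.read 1 (.const 3)))

/-- Compares the potential of the current profile in variable `9` with that of the candidate in
variable `14`. -/
def improvesE : Expr :=
  .sub (.mul (var 14) scaleE)
    (.add (.mul (var 9) scaleE) (.mul (.read 1 (.const 2)) (var 7)))

/-- The facility that is moved by the move in variable `8`. -/
def facilityE : Expr := .div (var 8) nE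

/-- The target of the move in variable `8`. -/
def targetE : Expr := .sub (var 8) (.mul nE facilityE)

/-- Tries the move in variable `8`; accepts it and starts over, or takes it back and proceeds to
the next move. -/
def searchBody : Prog :=
  .seq (assign 10 (.read 0 facilityE)) (.seq (.write 0 facilityE targetE)
    (.seq potentialProg
      (.ite improvesE
        (.seq (assign 9 (var 14)) (assign 8 (.const 0)))
        (.seq (.write 0 facilityE (var 10)) (assign 8 (.add (var 8) (.const 1)))))))

/-- Local search. -/
def searchLoop : Prog := .loop (.sub (.mul kE nE) (var 8)) searchBody

/-- The invariant of the local search. -/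
structure SearchInv (d : Data) (a b A : ℕ) (m : Mem) : Prop where
  data : Matches d m
  epsNum : m 1 2 = a
  epsDen : m 1 3 = b
  weight : m 7 0 = A
  valid : ∀ j < d.k, m 0 j < d.n
  current : m 9 0 = d.phi (m 0)
  index_le : m 8 0 ≤ d.k * d.n
  tried : ∀ q < m 8 0, ¬ d.Improves a b A (m 0) q

/-- The measure of the local search. -/
def searchMeasure (d : Data) (a b A : ℕ) (m : Mem) : ℕ :=
  d.rounds a b A (m 0) * (d.k * d.n + 1) + (d.k * d.n - m 8 0)

/-- The measure is lexicographic: an accepted move lowers `rounds`, whose unit `k * n + 1` outweighs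
the reset of the move index, and a rejected move advances the index. The restart after acceptance
keeps `tried` true of the current profile. -/
theorem exec_searchBody {d : Data} {a b A : ℕ} {m : Mem} (ha : 0 < a)
    (hphi : ∀ s, d.phi s ≤ d.k * A) (hS : (d.k * A).size ≤ S) (hS' : (d.k * d.n).size ≤ S)
    (hm : Bounded S m) (hI : SearchInv d a b A m) (hlt : m 8 0 < d.k * d.n) :
    Exec S ((d.n + 1) * (d.k + 1)) searchBody m fun m' =>
      SearchInv d a b A m' ∧ searchMeasure d a b A m' < searchMeasure d a b A m := by
  have hN : 0 < (d.n + 1) * (d.k + 1) := by positivity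
  obtain ⟨hd, h12, h13, h7, hv, h9, -, htried⟩ := hI
  have hn : 0 < d.n := Nat.pos_of_ne_zero fun h => by simp [h] at hlt
  have htarget : m 8 0 - d.n * (m 8 0 / d.n) < d.n := by
    have h1 := Nat.mod_lt (m 8 0) hn
    have h2 := Nat.div_add_mod (m 8 0) d.n
    omega
  refine .seq (.write hm hN (hm _ _) fun hm₁ => .seq (.write hm₁ hN ?_ fun hm₂ => .seq
    ((exec_potentialProg (d := d) ?_ (size_le_of_le (hphi _) hS) hm₂).mono le_rfl
    fun m₃ _ ⟨hf, h14⟩ hm₃ => ?_)))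
  · simp only [targetE, facilityE, Expr.eval]
    exact size_le_of_le (Nat.sub_le _ _) (by simpa using hm 8 0)
  · refine hd.congr fun a ha ha' => ?_
    simp [ha'.ne', (ha.trans (by norm_num : 7 < 10)).ne]
  have e0 : m₃ 0 = d.move (m 0) (m 8 0) := by
    rw [hf 0 (by norm_num)]
    simp [Data.move, targetE, facilityE, Expr.eval, hd.n]
  have e10 : m₃ 10 0 = m 0 (m 8 0 / d.n) := by
    rw [hf 10 (by norm_num)]
    simp [facilityE, Expr.eval, hd.n]
  have ef : ∀ a < 10, 0 < a → m₃ a = m a := by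
    intro a ha ha'
    rw [hf a (by omega)]
    simp [ha.ne, ha'.ne']
  rw [← hf 0 (by norm_num), e0] at h14
  have hd₃ : Matches d m₃ := hd.congr fun a ha ha' => ef a (by omega) ha'
  have e1 := ef 1 (by norm_num) (by norm_num)
  have e7 := ef 7 (by norm_num) (by norm_num)
  have e8 := ef 8 (by norm_num) (by norm_num)
  have e9 := ef 9 (by norm_num) (by norm_num)
  have himp : improvesE.eval m₃ ≠ 0 ↔ d.Improves a b A (m 0) (m 8 0) := by
    simp only [improvesE, scaleE, Expr.eval, h14, hd₃.n, hd₃.k, e1, e7, e9, h12, h13, h7, h9,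
      Data.Improves]
    omega
  refine .ite hm₃ hN (fun hc => ?_) (fun hc => ?_)
  · have himp := himp.1 hc
    refine .seq (.write hm₃ hN (hm₃ _ _) fun hm₄ => .write hm₄ hN (by simp [Expr.eval])
      ⟨⟨?_, ?_, ?_, ?_, ?_, ?_, ?_, ?_⟩, ?_⟩)
    · refine hd₃.congr fun a ha ha' => ?_
      simp [(ha.trans (by norm_num : 7 < 8)).ne, (ha.trans (by norm_num : 7 < 9)).ne]
    · simpa [e1] using h12
    · simpa [e1] using h13
    · simpa [e7] using h7
    · intro j hj
      simp only [ne_eq, OfNat.zero_ne_ofNat, not_false_eq_true, Function.update_of_ne, e0,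
        Data.move, Function.update_apply]
      split_ifs
      exacts [htarget, hv j hj]
    · simp [Expr.eval, e0, h14]
    · simp [Expr.eval]
    · simp [Expr.eval]
    · have h1 := himp.rounds_lt ha (hphi _)
      simp only [searchMeasure, ne_eq, OfNat.zero_ne_ofNat, not_false_eq_true,
        Function.update_of_ne, e0, Function.update_self, Expr.eval]
      have h2 := Nat.mul_le_mul_right (d.k * d.n + 1) (Nat.succ_le_of_lt h1)
      rw [Nat.succ_mul] at h2
      omega
  · have himp : ¬ d.Improves a b A (m 0) (m 8 0) := fun h => himp.2 h hc
    -- The candidate was evaluated in place; the location saved in variable `10` restores the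
    -- profile.
    have hback : Function.update (m₃ 0) (facilityE.eval m₃) ((var 10).eval m₃) = m 0 := by
      simp [facilityE, Expr.eval, e0, e8, hd₃.n, e10, Data.move]
    refine .seq (.write hm₃ hN (hm₃ _ _) fun hm₄ => .write hm₄ hN ?_ ?_)
    · rw [hback]
      simp only [Expr.eval, ne_eq, OfNat.ofNat_ne_zero, not_false_eq_true, Function.update_of_ne,
        e8]
      exact size_le_of_le hlt hS'
    rw [hback]
    refine ⟨⟨?_, ?_, ?_, ?_, ?_, ?_, ?_, ?_⟩, ?_⟩
    · refine hd₃.congr fun a ha ha' => ?_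
      simp [(ha.trans (by norm_num : 7 < 8)).ne, ha'.ne']
    · simpa [e1] using h12
    · simpa [e1] using h13
    · simpa [e7] using h7
    · simpa using hv
    · simpa [e9] using h9
    · simpa [Expr.eval, e8] using hlt
    · intro q hq
      simp only [Expr.eval, Function.update_self, ne_eq, OfNat.ofNat_ne_zero, not_false_eq_true,
        Function.update_of_ne, e8, OfNat.zero_ne_ofNat] at hq ⊢
      rcases Nat.lt_succ_iff_lt_or_eq.1 hq with h | rfl
      exacts [htried q h, himp]
    · simp only [searchMeasure, Expr.eval, Function.update_self, ne_eq, OfNat.ofNat_ne_zero,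
        not_false_eq_true, Function.update_of_ne, e8, OfNat.zero_ne_ofNat]
      omega

theorem exec_searchLoop {d : Data} {a b A : ℕ} {m : Mem} (ha : 0 < a)
    (hphi : ∀ s, d.phi s ≤ d.k * A) (hS : (d.k * A).size ≤ S) (hS' : (d.k * d.n).size ≤ S)
    (hm : Bounded S m) (hI : SearchInv d a b A m) {r : ℕ} (hr : searchMeasure d a b A m ≤ r) :
    Exec S ((r + 1) * ((d.n + 1) * (d.k + 1))) searchLoop m fun m' =>
      (∀ j < d.k, m' 0 j < d.n) ∧ ∀ q < d.k * d.n, ¬ d.Improves a b A (m' 0) q := by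
  have hc : ∀ m, SearchInv d a b A m →
      (Expr.sub (.mul kE nE) (var 8)).eval m = d.k * d.n - m 8 0 := by
    intro m h
    simp [Expr.eval, h.data.k, h.data.n]
  refine (Exec.loop (SearchInv d a b A) (searchMeasure d a b A) (by positivity)
    (fun m hm hI h => ?_) r hm hI hr).mono le_rfl fun m' _ h => ⟨h.1.valid, fun q hq => ?_⟩
  · rw [hc m hI] at h
    exact exec_searchBody ha hphi hS hS' hm hI (by omega)
  · have h1 := h.2
    rw [hc m' h.1] at h1
    exact h.1.tried q (by omega)

/-! ### Clearing denominators -/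

/-- The common denominator of the first `v` weights, times `k!`. -/
def commonDen (k : ℕ) (den : ℕ → ℕ) (v : ℕ) : ℕ := k.factorial * ∏ u ∈ Finset.range v, den u

/-- The sum of the first `v` weights, times their common denominator. -/
def scaledSum (k : ℕ) (num den : ℕ → ℕ) : ℕ → ℕ
  | 0 => 0
  | v + 1 => scaledSum k num den v * den v + num v * commonDen k den v

theorem commonDen_succ (k : ℕ) (den : ℕ → ℕ) (v : ℕ) :
    commonDen k den (v + 1) = commonDen k den v * den v := by
  rw [commonDen, Finset.prod_range_succ, commonDen, mul_assoc]

/-- Computes the factorial of the number of facilities into variable `6`. -/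
def factorialProg : Prog :=
  .seq (assign 6 (.const 1)) (.loop (.sub kE (var 12))
    (.seq (assign 12 (.add (var 12) (.const 1))) (assign 6 (.mul (var 6) (var 12)))))

/-- Computes the common denominator into variable `6` and the scaled sum of the weights into
variable `7`. -/
def sumProg : Prog :=
  .loop (.sub nE (var 11))
    (.seq (assign 7 (.add (.mul (var 7) (.read 4 (var 11))) (.mul (.read 3 (var 11)) (var 6))))
      (.seq (assign 6 (.mul (var 6) (.read 4 (var 11))))
        (assign 11 (.add (var 11) (.const 1)))))

/-- The invariant of `factorialProg`. -/
structure FactorialInv (m₀ m : Mem) : Prop where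
  frame : ∀ a, a ≠ 6 → a ≠ 12 → m a = m₀ a
  index_le : m 12 0 ≤ m₀ 1 1
  value : m 6 0 = (m 12 0).factorial

theorem exec_factorialProg {m : Mem} (hm : Bounded S m) (h12 : m 12 0 = 0) (hS₁ : 1 ≤ S)
    (hS : (m 1 1).factorial.size ≤ S) :
    Exec S (m 1 1 + 1) factorialProg m fun m' =>
      (∀ a, a ≠ 6 → a ≠ 12 → m' a = m a) ∧ m' 6 0 = (m 1 1).factorial := by
  have hN : 0 < m 1 1 + 1 := Nat.succ_pos _
  have hc : ∀ m', FactorialInv m m' → (Expr.sub kE (var 12)).eval m' = m 1 1 - m' 12 0 := by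
    intro m' h
    simp [Expr.eval, h.frame 1 (by norm_num) (by norm_num)]
  refine .seq (.write hm hN (by simpa [Expr.eval] using hS₁) fun hm₁ =>
    (Exec.loop (FactorialInv m) (fun m' => m 1 1 - m' 12 0) one_pos
    (fun m' hm' hI h => ?_) (m 1 1) hm₁ ⟨?_, ?_, ?_⟩ (Nat.sub_le _ _)).mono (by omega)
    fun m' _ h => ⟨h.1.frame, ?_⟩)
  · rw [hc m' hI] at h
    obtain ⟨hf, -, h6⟩ := hI
    refine .seq (.write hm' one_pos ?_ fun hm₂ => .write hm₂ one_pos ?_ ⟨⟨?_, ?_, ?_⟩, ?_⟩)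
    · simp only [Expr.eval]
      exact size_le_of_le (show m' 12 0 + 1 ≤ m 1 1 by omega) (hm 1 1)
    · refine size_le_of_le (y := (m 1 1).factorial) ?_ hS
      simpa [Expr.eval, h6, Nat.factorial_succ, mul_comm] using
        Nat.factorial_le (show m' 12 0 + 1 ≤ m 1 1 by omega)
    · intro a h1 h2
      simp [h1, h2, hf]
    · simp [Expr.eval]; omega
    · simp [Expr.eval, h6, Nat.factorial_succ, mul_comm]
    · simp [Expr.eval]; omega
  · intro a h1 h2
    simp [h1]
  · simp [h12]
  · simp [Expr.eval, h12]
  · have h1 := h.2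
    rw [hc m' h.1] at h1
    have h2 := h.1.index_le
    rw [h.1.value, show m' 12 0 = m 1 1 by omega]

/-- The invariant of `sumProg`. -/
structure SumInv (m₀ m : Mem) : Prop where
  frame : ∀ a, a ≠ 6 → a ≠ 7 → a ≠ 11 → m a = m₀ a
  index_le : m 11 0 ≤ m₀ 1 0
  den : m 6 0 = commonDen (m₀ 1 1) (m₀ 4) (m 11 0)
  sum : m 7 0 = scaledSum (m₀ 1 1) (m₀ 3) (m₀ 4) (m 11 0)

theorem exec_sumProg {m : Mem} (hm : Bounded S m) (h11 : m 11 0 = 0) (h7 : m 7 0 = 0)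
    (h6 : m 6 0 = (m 1 1).factorial)
    (hS₁ : ∀ v ≤ m 1 0, (commonDen (m 1 1) (m 4) v).size ≤ S)
    (hS₂ : ∀ v ≤ m 1 0, (scaledSum (m 1 1) (m 3) (m 4) v).size ≤ S) :
    Exec S (m 1 0 + 1) sumProg m fun m' =>
      (∀ a, a ≠ 6 → a ≠ 7 → a ≠ 11 → m' a = m a)
        ∧ m' 6 0 = commonDen (m 1 1) (m 4) (m 1 0)
        ∧ m' 7 0 = scaledSum (m 1 1) (m 3) (m 4) (m 1 0) := by
  have hc : ∀ m', SumInv m m' → (Expr.sub nE (var 11)).eval m' = m 1 0 - m' 11 0 := by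
    intro m' h
    simp [Expr.eval, h.frame 1 (by norm_num) (by norm_num) (by norm_num)]
  refine (Exec.loop (SumInv m) (fun m' => m 1 0 - m' 11 0) one_pos
    (fun m' hm' hI h => ?_) (m 1 0) hm ⟨fun _ _ _ _ => rfl, ?_, ?_, ?_⟩
    (Nat.sub_le _ _)).mono (by omega) fun m' _ h => ⟨h.1.frame, ?_⟩
  · rw [hc m' hI] at h
    obtain ⟨hf, -, h6, h7⟩ := hI
    have e3 := hf 3 (by norm_num) (by norm_num) (by norm_num)
    have e4 := hf 4 (by norm_num) (by norm_num) (by norm_num)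
    have hlt : m' 11 0 + 1 ≤ m 1 0 := by omega
    refine .seq (.write hm' one_pos ?_ fun hm₁ => .seq (.write hm₁ one_pos ?_ fun hm₂ =>
      .write hm₂ one_pos ?_ ⟨⟨?_, ?_, ?_, ?_⟩, ?_⟩))
    -- Variable `7` is updated before variable `6`, so the new numerator is multiplied by the
    -- previous common denominator.
    · simpa [Expr.eval, h6, h7, e3, e4, scaledSum] using hS₂ _ hlt
    · simpa [Expr.eval, h6, e4, commonDen_succ] using hS₁ _ hlt
    · simpa [Expr.eval] using size_le_of_le hlt (hm 1 0)
    · intro a h1 h2 h3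
      simp [h1, h2, h3, hf]
    · simpa [Expr.eval] using hlt
    · simp [Expr.eval, h6, e4, commonDen_succ]
    · simp [Expr.eval, h6, h7, e3, e4, scaledSum]
    · simp [Expr.eval]; omega
  · simp [h11]
  · simp [h11, h6, commonDen]
  · simp [h11, h7, scaledSum]
  · have h1 := h.2
    rw [hc m' h.1] at h1
    have h2 := h.1.index_le
    have h3 : m' 11 0 = m 1 0 := by omega
    rw [h.1.den, h.1.sum, h3]
    exact ⟨rfl, rfl⟩

/-- The whole algorithm. -/
def mainProg : Prog :=
  .seq factorialProg (.seq sumProg (.seq potentialProg (.seq (assign 9 (var 14)) searchLoop)))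

end FLGProgram

/-! ### Binary lengths of sums, products and the input -/

theorem Nat.size_sum_le {ι : Type*} (s : Finset ι) (f : ι → ℕ) :
    (∑ i ∈ s, f i).size ≤ ∑ i ∈ s, (f i).size :=
  Finset.le_sum_of_subadditive Nat.size Nat.size_zero.le Nat.size_add_le s f

theorem Nat.size_prod_le {ι : Type*} (s : Finset ι) (f : ι → ℕ) :
    (∏ i ∈ s, f i).size ≤ 1 + ∑ i ∈ s, (f i).size := by
  classical
  induction s using Finset.induction_on with
  | empty => simp
  | insert i s hi ih =>
    rw [Finset.prod_insert hi, Finset.sum_insert hi]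
    exact (Nat.size_mul_le _ _).trans (by omega)

/-- From `k! ≤ k ^ k`. The bound is polynomial in `k` itself, which suffices because the facilities
are listed one by one. -/
theorem Nat.size_factorial_le (k : ℕ) : k.factorial.size ≤ 1 + k * k.size := by
  have h := Nat.size_prod_le (Finset.range k) fun _ => k
  simp only [Finset.prod_const, Finset.card_range, Finset.sum_const, smul_eq_mul] at h
  exact (Nat.size_le_size k.factorial_le_pow).trans h

namespace RAM

theorem size_getD_le (l : List ℕ) (i : ℕ) :
    (l.getD i 0).size ≤ (l.map fun x => x.size + 1).sum := by
  induction l generalizing i with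
  | nil => simp
  | cons x l ih =>
    cases i with
    | zero => simp only [List.getD_cons_zero, List.map_cons, List.sum_cons]; omega
    | succ i =>
      have := ih i
      simp only [List.getD_cons_succ, List.map_cons, List.sum_cons]; omega

theorem bounded_initMem (L : List (List ℕ)) : Bounded (inputSize L) (initMem L) := by
  intro a i
  cases a with
  | zero => simp [initMem]
  | succ a =>
    simp only [initMem, inputSize]
    induction L generalizing a with
    | nil => simp
    | cons l L ih =>
      cases a with
      | zero =>
        have := size_getD_le l i
        simp only [List.getD_cons_zero, List.map_cons, List.sum_cons]; omega
      | succ a =>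
        have := ih a
        simp only [List.getD_cons_succ, List.map_cons, List.sum_cons]; omega

theorem Bounded.mono {S S' : ℕ} {m : Mem} (h : Bounded S m) (hS : S ≤ S') : Bounded S' m :=
  fun a i => (h a i).trans hS

end RAM

/-! ### The whole program and the exactness of its arithmetic -/

namespace FLGProgram

open RAM

variable {S : ℕ}

/-- The number `y` is an upper bound for `b / a`, the reciprocal of the accuracy; it enters the
number of accepted moves. -/
theorem exec_mainProg {d : Data} {a b y : ℕ} {m : Mem} (hm : Bounded S m) (hn : 0 < d.n)
    (ha : 0 < a) (hb : b ≤ a * y) (hD : d.D = commonDen d.k d.den d.n)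
    (h10 : m 1 0 = d.n) (h11 : m 1 1 = d.k) (h12 : m 1 2 = a) (h13 : m 1 3 = b)
    (h3 : m 3 = d.num) (h4 : m 4 = d.den) (h5 : m 5 = d.adj) (h0 : m 0 = 0)
    (hz : ∀ i, 6 ≤ i → m i 0 = 0)
    (hphi : ∀ s, d.phi s ≤ d.k * scaledSum d.k d.num d.den d.n)
    (hS₀ : ∀ v ≤ d.n, (commonDen d.k d.den v).size ≤ S)
    (hS₁ : ∀ v ≤ d.n, (scaledSum d.k d.num d.den v).size ≤ S)
    (hS₂ : (d.k * scaledSum d.k d.num d.den d.n).size ≤ S) (hS₃ : (d.k * d.n).size ≤ S) :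
    Exec S ((d.k * (d.n * d.k) * (1 + y) * (d.k * d.n + 1) + d.k * d.n + 1)
        * ((d.n + 1) * (d.k + 1))) mainProg m fun m' =>
      (∀ j < d.k, m' 0 j < d.n) ∧ ∀ q < d.k * d.n,
        ¬ d.Improves a b (scaledSum d.k d.num d.den d.n) (m' 0) q := by
  set r := d.k * (d.n * d.k) * (1 + y) * (d.k * d.n + 1) + d.k * d.n with hr
  have hN : 0 < (r + 1) * ((d.n + 1) * (d.k + 1)) := by positivity
  have hN₁ : (d.n + 1) * (d.k + 1) ≤ (r + 1) * ((d.n + 1) * (d.k + 1)) :=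
    Nat.le_mul_of_pos_left _ (Nat.succ_pos _)
  have hN₂ : d.k + 1 ≤ (d.n + 1) * (d.k + 1) := Nat.le_mul_of_pos_left _ (Nat.succ_pos _)
  have hN₃ : d.n + 1 ≤ (d.n + 1) * (d.k + 1) := Nat.le_mul_of_pos_right _ (Nat.succ_pos _)
  have hfact : (m 1 1).factorial.size ≤ S := by
    simpa [h11, commonDen] using hS₀ 0 (Nat.zero_le _)
  have hone : 1 ≤ S := by
    refine le_trans ?_ hfact
    exact Nat.size_pos.2 (Nat.factorial_pos _)
  refine .seq ((exec_factorialProg hm (hz 12 (by norm_num)) hone hfact).mono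
    (by rw [h11]; exact hN₂.trans hN₁) fun m₁ _ ⟨hf₁, h6⟩ hm₁ => .seq ?_)
  have e0 := hf₁ 0 (by norm_num) (by norm_num)
  have e1 := hf₁ 1 (by norm_num) (by norm_num)
  have e3 := hf₁ 3 (by norm_num) (by norm_num)
  have e4 := hf₁ 4 (by norm_num) (by norm_num)
  have e5 := hf₁ 5 (by norm_num) (by norm_num)
  have e7 := hf₁ 7 (by norm_num) (by norm_num)
  have e8 := hf₁ 8 (by norm_num) (by norm_num)
  have e11 := hf₁ 11 (by norm_num) (by norm_num)
  refine (exec_sumProg hm₁ (by rw [e11, hz 11 (by norm_num)]) (by rw [e7, hz 7 (by norm_num)])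
    (by rw [h6, e1]) (by rw [e1, e4, h10, h11, h4]; exact hS₀)
    (by rw [e1, e3, e4, h10, h11, h3, h4]; exact hS₁)).mono
    (by rw [e1, h10]; exact hN₃.trans hN₁) fun m₂ _ ⟨hf₂, h6, h7⟩ hm₂ => .seq ?_
  rw [e1, e4, h10, h11, h4, ← hD] at h6
  rw [e1, e3, e4, h10, h11, h3, h4] at h7
  replace e0 := (hf₂ 0 (by norm_num) (by norm_num) (by norm_num)).trans e0
  replace e1 := (hf₂ 1 (by norm_num) (by norm_num) (by norm_num)).trans e1
  replace e3 := (hf₂ 3 (by norm_num) (by norm_num) (by norm_num)).trans e3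
  replace e4 := (hf₂ 4 (by norm_num) (by norm_num) (by norm_num)).trans e4
  replace e5 := (hf₂ 5 (by norm_num) (by norm_num) (by norm_num)).trans e5
  replace e8 := (hf₂ 8 (by norm_num) (by norm_num) (by norm_num)).trans e8
  have hd : Matches d m₂ := ⟨by rw [e1, h10], by rw [e1, h11], by rw [e3, h3], by rw [e4, h4],
    by rw [e5, h5], h6⟩
  refine (exec_potentialProg hd (size_le_of_le (hphi _) hS₂) hm₂).mono hN₁
    fun m₃ _ ⟨hf₃, h14⟩ hm₃ => .seq (.write hm₃ hN (hm₃ _ _) fun hm₄ =>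
      exec_searchLoop ha hphi hS₂ hS₃ hm₄ ?_ ?_)
  · replace e0 := (hf₃ 0 (by norm_num)).trans e0
    replace e1 := (hf₃ 1 (by norm_num)).trans e1
    replace e7 := (hf₃ 7 (by norm_num))
    replace e8 := (hf₃ 8 (by norm_num)).trans e8
    have h8 : m₃ 8 0 = 0 := by rw [e8, hz 8 (by norm_num)]
    refine ⟨hd.congr fun i hi _ => ?_, ?_, ?_, ?_, ?_, ?_, ?_, ?_⟩
    · simpa [(hi.trans (by norm_num : 7 < 9)).ne] using hf₃ i (by omega)
    · simpa [e1] using h12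
    · simpa [e1] using h13
    · simpa [e7] using h7
    -- The search starts from the zeros of the output array: all facilities at vertex `0`, which
    -- exists since `0 < d.n`.
    · simpa [e0, h0] using fun _ _ => hn
    · simp [Expr.eval, h14, hf₃ 0]
    · simp [h8]
    · simp [h8]
  -- Initially `rounds` is at most `k * A * (n * k * (a + b)) / (a * A)`, and `a + b ≤ a * (1 + y)`.
  · refine add_le_add (Nat.mul_le_mul_right _ (Nat.div_le_of_le_mul
      ((Nat.sub_le _ _).trans ?_))) (Nat.sub_le _ _)
    calc _ ≤ d.k * scaledSum d.k d.num d.den d.n * (d.n * d.k * (a + a * y)) := by gcongr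
      _ = _ := by ring

theorem cast_scaledSum (k : ℕ) (num den : ℕ → ℕ) (v : ℕ) (h : ∀ u < v, 0 < den u) :
    (scaledSum k num den v : ℝ)
      = commonDen k den v * ∑ u ∈ Finset.range v, (num u : ℝ) / den u := by
  induction v with
  | zero => simp [scaledSum]
  | succ v ih =>
    have hv : (den v : ℝ) ≠ 0 := by exact_mod_cast (h v (Nat.lt_succ_self v)).ne'
    rw [scaledSum, commonDen_succ, Finset.sum_range_succ]
    push_cast
    rw [ih fun u hu => h u (hu.trans (Nat.lt_succ_self v))]
    field_simp

/-- A crude bound, obtained by replacing each weight by its numerator; it serves only to bound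
binary lengths. -/
theorem scaledSum_le (k : ℕ) (num den : ℕ → ℕ) (v : ℕ) (h : ∀ u < v, 0 < den u) :
    scaledSum k num den v ≤ commonDen k den v * ∑ u ∈ Finset.range v, num u := by
  induction v with
  | zero => simp [scaledSum]
  | succ v ih =>
    have hv := h v (Nat.lt_succ_self v)
    have h1 := Nat.mul_le_mul_right (den v) (ih fun u hu => h u (hu.trans (Nat.lt_succ_self v)))
    have h2 : num v * commonDen k den v ≤ num v * commonDen k den v * den v :=
      Nat.le_mul_of_pos_right _ hv
    rw [scaledSum, commonDen_succ, Finset.sum_range_succ]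
    linarith

/-- A client contributes at most `k` terms, each at most its scaled weight. This bounds both the
stored values and the number of accepted moves. -/
theorem phi_le {d : Data} (hD : d.D = commonDen d.k d.den d.n) (hden : ∀ u < d.n, 0 < d.den u)
    (s : ℕ → ℕ) : d.phi s ≤ d.k * scaledSum d.k d.num d.den d.n := by
  have h : (d.phi s : ℝ) ≤ d.k * scaledSum d.k d.num d.den d.n := by
    rw [cast_scaledSum _ _ _ _ hden, ← hD, Data.phi, Nat.cast_sum, Finset.mul_sum, Finset.mul_sum]
    refine Finset.sum_le_sum fun v _ => ?_
    have h1 : d.inner s v d.k ≤ d.k * (d.num v * d.D / d.den v) := by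
      refine (Finset.sum_le_card_nsmul _ _ _ fun c _ => Nat.div_le_self _ _).trans ?_
      rw [Finset.card_range, smul_eq_mul]
      exact Nat.mul_le_mul_right _ (d.count_le _ _ _)
    calc (d.inner s v d.k : ℝ) ≤ ((d.k * (d.num v * d.D / d.den v) : ℕ) : ℝ) := by
          exact_mod_cast h1
      _ = d.k * ((d.num v * d.D / d.den v : ℕ) : ℝ) := by push_cast; rfl
      _ ≤ d.k * (((d.num v * d.D : ℕ) : ℝ) / d.den v) := by
          gcongr
          exact Nat.cast_div_le
      _ = _ := by push_cast; ring
  exact_mod_cast h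

/-- No rounding occurs: `i ≤ k` divides `k!` and `den v` divides the product of the denominators, so
`den v * i` divides `num v * D`. -/
theorem cast_inner {d : Data} (hD : d.D = commonDen d.k d.den d.n)
    (hden : ∀ u < d.n, 0 < d.den u) (s : ℕ → ℕ) {v : ℕ} (hv : v < d.n) :
    (d.inner s v d.k : ℝ)
      = d.D * ∑ i ∈ Finset.Icc 1 (d.count s v d.k), ((d.num v : ℝ) / d.den v) / (i : ℝ) := by
  rw [Data.inner, Finset.range_eq_Ico, Finset.sum_Ico_add' (fun i => d.num v * d.D / d.den v / i),
    zero_add, Finset.Ico_add_one_right_eq_Icc, Nat.cast_sum, Finset.mul_sum]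
  refine Finset.sum_congr rfl fun i hi => ?_
  obtain ⟨hi₁, hi₂⟩ := Finset.mem_Icc.1 hi
  have hdvd : d.den v * i ∣ d.num v * d.D := by
    rw [hD, commonDen, mul_comm (d.den v)]
    exact Dvd.dvd.mul_left (mul_dvd_mul
      (Nat.dvd_factorial hi₁ (hi₂.trans (d.count_le _ _ _)))
      (Finset.dvd_prod_of_mem _ (Finset.mem_range.2 hv))) _
  have h1 : (d.den v : ℝ) ≠ 0 := by exact_mod_cast (hden v hv).ne'
  have h2 : (i : ℝ) ≠ 0 := by exact_mod_cast (Nat.pos_of_ne_zero (by omega)).ne'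
  rw [Nat.div_div_eq_div_mul, Nat.cast_div hdvd (by push_cast; exact mul_ne_zero h1 h2)]
  push_cast
  field_simp

end FLGProgram

/-! ### Encoded instances: correctness of the output and running time -/

namespace FLGInstance

open RAM FLGProgram

/-- The data of an instance as they are kept in the memory. -/
noncomputable def data (I : FLGInstance) (ε : ℚ≥0) : Data where
  n := I.n
  k := I.k
  D := commonDen I.k (initMem (I.encode ε) 4) I.n
  num := initMem (I.encode ε) 3
  den := initMem (I.encode ε) 4
  adj := initMem (I.encode ε) 5

variable (I : FLGInstance) (ε : ℚ≥0)

theorem data_num (v : Fin I.n) : (I.data ε).num v = (I.H.w v).num := by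
  simp [data, encode, initMem]

theorem data_den (v : Fin I.n) : (I.data ε).den v = (I.H.w v).den := by
  simp [data, encode, initMem]

theorem data_den_pos : ∀ u < (I.data ε).n, 0 < (I.data ε).den u := by
  intro u hu
  have h := I.data_den ε ⟨u, hu⟩
  simp only at h
  rw [h]
  exact NNRat.den_pos _

theorem data_weight (v : Fin I.n) :
    ((I.data ε).num v : ℝ) / (I.data ε).den v = (I.H.w v : ℝ) := by
  rw [data_num, data_den, NNRat.cast_def]

theorem data_test (v z : Fin I.n) :
    (I.data ε).test v z ≠ 0 ↔ z ∈ I.H.shoppingRange v := by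
  classical
  have hlt : (v : ℕ) * I.n + z < I.n * I.n := by
    calc _ < (v : ℕ) * I.n + I.n := by omega
      _ = (v + 1) * I.n := by ring
      _ ≤ _ := Nat.mul_le_mul_right _ v.2
  have hadj : (I.data ε).adj (v * I.n + z) = if I.H.Adj v z then 1 else 0 := by
    have h1 : (⟨v * I.n + z, hlt⟩ : Fin (I.n * I.n)).divNat = v := by
      ext
      simp only [Fin.divNat]
      rw [mul_comm, Nat.mul_add_div I.n_pos, Nat.div_eq_of_lt z.2, add_zero]
    have h2 : (⟨v * I.n + z, hlt⟩ : Fin (I.n * I.n)).modNat = z := by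
      ext
      simp [Fin.modNat, Nat.mod_eq_of_lt]
    simp [data, encode, initMem, hlt, h1, h2]
  -- With truncated subtraction, `(z - v) + (v - z)` is the distance of `z` and `v`, so one minus it
  -- is nonzero only for equal vertices.
  have hself : 1 - (((z : ℕ) - v) + (v - z)) ≠ 0 ↔ z = v := by
    rw [Fin.ext_iff]; omega
  change (I.data ε).adj (v * I.n + z) + (1 - (((z : ℕ) - v) + (v - z))) ≠ 0 ↔ z = v ∨ I.H.Adj v z
  rw [← hself, hadj]
  by_cases h : I.H.Adj v z <;> simp [h]

theorem data_count {s : ℕ → ℕ} {s' : Fin I.k → Fin I.n} (hs : ∀ j : Fin I.k, s j = s' j)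
    (v : Fin I.n) :
    (I.data ε).count s v I.k = (I.H.facilitiesInRange s' v).card := by
  classical
  rw [Data.count, ← Fin.sum_univ_eq_sum_range
    (fun j => if (I.data ε).test v (s j) ≠ 0 then 1 else 0), HostGraph.facilitiesInRange,
    Finset.card_filter]
  refine Finset.sum_congr rfl fun j _ => ?_
  simp only [hs, data_test]

theorem data_phi {s : ℕ → ℕ} {s' : Fin I.k → Fin I.n} (hs : ∀ j : Fin I.k, s j = s' j) :
    ((I.data ε).phi s : ℝ) = (I.data ε).D * I.H.potential s' := by
  change ((∑ v ∈ Finset.range I.n, (I.data ε).inner s v I.k : ℕ) : ℝ) = _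
  rw [Nat.cast_sum, HostGraph.potential, Finset.mul_sum,
    ← Fin.sum_univ_eq_sum_range (fun v => (((I.data ε).inner s v I.k : ℕ) : ℝ))]
  refine Finset.sum_congr rfl fun v _ => ?_
  have h := cast_inner (d := I.data ε) rfl (I.data_den_pos ε) s v.2
  rw [I.data_weight ε v] at h
  rw [← I.data_count ε hs v]
  exact h

theorem data_scaledSum :
    (scaledSum I.k (I.data ε).num (I.data ε).den I.n : ℝ)
      = (I.data ε).D * ∑ v, (I.H.w v : ℝ) := by
  rw [cast_scaledSum _ _ _ I.n (I.data_den_pos ε),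
    ← Fin.sum_univ_eq_sum_range (fun v => ((I.data ε).num v : ℝ) / (I.data ε).den v)]
  simp only [data_weight]
  rfl

theorem data_D_pos : 0 < (I.data ε).D :=
  Nat.mul_pos (Nat.factorial_pos _)
    (Finset.prod_pos fun u hu => I.data_den_pos ε u (Finset.mem_range.1 hu))

/-- A profile without improving moves is an approximate equilibrium. -/
theorem isCorrectOutput_of_not_improves (hε : 0 < ε) {s : ℕ → ℕ} (hs : ∀ j < I.k, s j < I.n)
    (h : ∀ q < I.k * I.n, ¬ (I.data ε).Improves ε.num ε.den
      (scaledSum I.k (I.data ε).num (I.data ε).den I.n) s q) :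
    I.IsCorrectOutput ε s := by
  refine ⟨fun j => ⟨s j, hs j j.2⟩, fun j => rfl, ?_⟩
  have hε' : (0 : ℝ) < ε := by exact_mod_cast hε
  refine I.H.isApproxEquilibrium_of_gap hε' fun j v => ?_
  -- The move of facility `j` to vertex `v` has the code `j * n + v`.
  have hq : (j : ℕ) * I.n + v < I.k * I.n := by
    calc _ < (j : ℕ) * I.n + I.n := by omega
      _ = (j + 1) * I.n := by ring
      _ ≤ _ := Nat.mul_le_mul_right _ j.2
  have h1 := h _ hq
  have hdiv : ((j : ℕ) * I.n + v) / I.n = j := by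
    rw [mul_comm, Nat.mul_add_div I.n_pos, Nat.div_eq_of_lt v.2, add_zero]
  have hmove : (I.data ε).move s (j * I.n + v) = Function.update s j v := by
    change Function.update s ((j * I.n + v) / I.n)
      (j * I.n + v - I.n * ((j * I.n + v) / I.n)) = _
    rw [hdiv, mul_comm I.n, Nat.add_sub_cancel_left]
  rw [Data.Improves, hmove, not_lt] at h1
  have h2 : ((I.data ε).phi (Function.update s j v) : ℝ) * (I.n * I.k * (ε.num + ε.den))
      ≤ (I.data ε).phi s * (I.n * I.k * (ε.num + ε.den))
        + ε.num * scaledSum I.k (I.data ε).num (I.data ε).den I.n := by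
    exact_mod_cast h1
  rw [I.data_phi ε (s' := fun j => ⟨s j, hs j j.2⟩) fun j => rfl,
    I.data_phi ε (s' := Function.update (fun j : Fin I.k => ⟨s j, hs j j.2⟩) j v) ?_,
    data_scaledSum] at h2
  · have hD : (0 : ℝ) < (I.data ε).D := by exact_mod_cast I.data_D_pos ε
    have hb : (0 : ℝ) < ε.den := by exact_mod_cast ε.den_pos
    have h3 : (ε : ℝ) * ε.den = ε.num := by
      rw [NNRat.cast_def]; field_simp
    -- Since `num + den = (1 + ε) * den`, the integer inequality is the required one multiplied by
    -- `D * den`.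
    refine le_of_mul_le_mul_left ?_ (mul_pos hD hb)
    rw [Fintype.card_fin]
    rw [← h3] at h2
    linarith
  · intro i
    simp only [Function.update_apply, Fin.ext_iff]
    split_ifs <;> rfl

/-- The values `n` and `k`, not only their lengths, are bounded by the input size, because the
encoding has an entry for each weight and for each facility. -/
theorem le_inputSize_encode :
    I.n + I.k + I.n.size + I.k.size
      + (∑ u ∈ Finset.range I.n, ((I.data ε).num u).size
        + ∑ u ∈ Finset.range I.n, ((I.data ε).den u).size) ≤ inputSize (I.encode ε) := by
  rw [← Fin.sum_univ_eq_sum_range (fun u => ((I.data ε).num u).size),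
    ← Fin.sum_univ_eq_sum_range (fun u => ((I.data ε).den u).size)]
  simp only [data_num, data_den, inputSize, encode, List.map_ofFn, List.sum_ofFn,
    Function.comp_def, List.map_cons, List.map_nil, List.sum_cons, List.sum_nil,
    List.map_replicate, List.sum_replicate, Finset.sum_add_distrib, Finset.sum_const,
    Finset.card_univ, Fintype.card_fin, smul_eq_mul, Nat.size_one]
  omega

/-- Since `1 / ε = den / num`, the ceiling can serve as `y` in `exec_mainProg`. -/
theorem den_le_num_mul_ceil (hε : 0 < ε) : ε.den ≤ ε.num * ⌈1 / ε⌉₊ := by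
  have h1 : (ε.num : ℚ≥0) * (1 / ε) = ε.den := by
    have h2 : (ε.den : ℚ≥0) ≠ 0 := by exact_mod_cast ε.den_pos.ne'
    have h3 : ε * ε.den = ε.num := NNRat.mul_den_eq_num ε
    rw [← h3]
    field_simp
  have h4 : (ε.den : ℚ≥0) ≤ ε.num * ⌈1 / ε⌉₊ := by
    rw [← h1]
    gcongr
    exact Nat.le_ceil _
  exact_mod_cast h4

theorem size_commonDen_le {v : ℕ} (hv : v ≤ I.n) :
    (commonDen I.k (I.data ε).den v).size
      ≤ 2 + I.k * I.k.size + ∑ u ∈ Finset.range I.n, ((I.data ε).den u).size := by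
  have h1 := Nat.size_factorial_le I.k
  have h2 := Nat.size_prod_le (Finset.range v) (I.data ε).den
  have h3 : ∑ u ∈ Finset.range v, ((I.data ε).den u).size
      ≤ ∑ u ∈ Finset.range I.n, ((I.data ε).den u).size :=
    Finset.sum_le_sum_of_subset (Finset.range_mono hv)
  exact (Nat.size_mul_le _ _).trans (by omega)

theorem size_scaledSum_le {v : ℕ} (hv : v ≤ I.n) :
    (scaledSum I.k (I.data ε).num (I.data ε).den v).size
      ≤ 2 + I.k * I.k.size + (∑ u ∈ Finset.range I.n, ((I.data ε).num u).size
        + ∑ u ∈ Finset.range I.n, ((I.data ε).den u).size) := by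
  have h1 := I.size_commonDen_le ε hv
  have h2 := Nat.size_sum_le (Finset.range v) (I.data ε).num
  have h3 : ∑ u ∈ Finset.range v, ((I.data ε).num u).size
      ≤ ∑ u ∈ Finset.range I.n, ((I.data ε).num u).size :=
    Finset.sum_le_sum_of_subset (Finset.range_mono hv)
  exact (Nat.size_le_size (scaledSum_le _ _ _ _ fun u hu =>
    I.data_den_pos ε u (hu.trans_le hv))).trans ((Nat.size_mul_le _ _).trans (by omega))

/-- A bound for the running time. -/
noncomputable def timeBound : Polynomial ℕ :=
  .C mainProg.weight * ((.X * (.X * .X) * (1 + .X) * (.X * .X + 1) + .X * .X + 1)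
    * ((.X + 1) * (.X + 1))) * ((.X + 2) ^ 2 + 1)

/-- Local search is an FPTAS for approximate equilibria. -/
theorem hasFPTAS : HasFPTAS encode IsCorrectOutput := by
  refine ⟨mainProg, timeBound, fun I ε hε => ?_⟩
  set x := inputSize (I.encode ε) with hx
  have h := I.le_inputSize_encode ε
  rw [← hx] at h
  have hk : I.k * I.k.size ≤ x * x := Nat.mul_le_mul (by omega) (by omega)
  -- All lengths that occur are at most `2 + x * x + 2 * x`; the square is a convenient common cell
  -- length.
  have hS : ∀ y, y ≤ 2 + x * x + 2 * x → y ≤ (x + 2) ^ 2 := fun y hy => by nlinarith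
  have hA : ((I.data ε).k * scaledSum (I.data ε).k (I.data ε).num (I.data ε).den (I.data ε).n).size
      ≤ 2 + x * x + 2 * x := by
    have h1 := I.size_scaledSum_le ε le_rfl
    refine (Nat.size_mul_le _ _).trans ?_
    change I.k.size + (scaledSum I.k (I.data ε).num (I.data ε).den I.n).size ≤ _
    omega
  have hkn : ((I.data ε).k * (I.data ε).n).size ≤ 2 + x * x + 2 * x := by
    refine (Nat.size_mul_le _ _).trans ?_
    change I.k.size + I.n.size ≤ _
    omega
  obtain ⟨t, m, hrun, ht, -, hvalid, himp⟩ := exec_mainProg (S := (x + 2) ^ 2) (d := I.data ε)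
    (a := ε.num) (b := ε.den) (y := ⌈1 / ε⌉₊) (m := initMem (I.encode ε))
    ((bounded_initMem _).mono (hS _ (by rw [← hx]; nlinarith))) I.n_pos
    (NNRat.num_pos.2 hε) (den_le_num_mul_ceil ε hε) rfl rfl rfl rfl rfl rfl rfl rfl rfl
    (fun i hi => by
      obtain ⟨i, rfl⟩ := Nat.exists_eq_add_of_le' hi
      simp [initMem, encode])
    (phi_le rfl (I.data_den_pos ε))
    (fun v hv => hS _ ((I.size_commonDen_le ε hv).trans (by omega)))
    (fun v hv => hS _ ((I.size_scaledSum_le ε hv).trans (by omega)))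
    (hS _ hA) (hS _ hkn)
  refine ⟨t, m, hrun, ht.trans ?_, I.isCorrectOutput_of_not_improves ε hε hvalid himp⟩
  -- The polynomial is the bound of `exec_mainProg` with `n`, `k`, `⌈1 / ε⌉₊` and `x` all replaced
  -- by the larger `x + ⌈1 / ε⌉₊`.
  have hn : I.n ≤ x + ⌈1 / ε⌉₊ := by omega
  have hk : I.k ≤ x + ⌈1 / ε⌉₊ := by omega
  have hy : ⌈1 / ε⌉₊ ≤ x + ⌈1 / ε⌉₊ := by omega
  have hx' : x ≤ x + ⌈1 / ε⌉₊ := by omega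
  simp only [timeBound, Polynomial.eval_mul, Polynomial.eval_add, Polynomial.eval_pow,
    Polynomial.eval_C, Polynomial.eval_X, Polynomial.eval_one, Polynomial.eval_ofNat]
  change _ * ((I.k * (I.n * I.k) * (1 + ⌈1 / ε⌉₊) * (I.k * I.n + 1) + I.k * I.n + 1)
      * ((I.n + 1) * (I.k + 1))) * _ ≤ _
  gcongr

end FLGInstance

theorem mainTheorem7 :
    -- Rosenthal's function is an exact potential of the Uniform-2-FLG
    (∀ (V : Type*) [Fintype V] (H : HostGraph V) (k : ℕ) (s : Fin k → V) (j : Fin k) (v : V),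
      H.potential (Function.update s j v) - H.potential s
        = H.load (Function.update s j v) j - H.load s j) ∧
    -- every sequence of `(1+ε)`-best response steps is short, and where it cannot be continued
    -- it has reached a `(1+ε)`-approximate equilibrium
    (∃ C : ℝ, 0 < C ∧
      ∀ (V : Type*) [Fintype V] (H : HostGraph V) (k : ℕ) (ε : ℝ), 0 < ε →
        ∀ (T : ℕ) (s : ℕ → Fin k → V),
          (∀ t < T, H.ApproxBestResponseStep ε (s t) (s (t + 1))) →
          (T : ℝ) ≤ C * (max 1 (1 / ε) * (k : ℝ) ^ 2 * Real.log ((k : ℝ) + 1)) ∧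
          ((¬ ∃ s' : Fin k → V, H.ApproxBestResponseStep ε (s T) s') →
            H.IsApproxEquilibrium (1 + ε) (s T))) ∧
    -- computing a `(1+ε)`-approximate equilibrium has an FPTAS
    RAM.HasFPTAS FLGInstance.encode FLGInstance.IsCorrectOutput := by
  refine ⟨fun V _ H k s j v => H.potential_update_sub s j v, ⟨6, by norm_num, ?_⟩,
    FLGInstance.hasFPTAS⟩
  intro V _ H k ε hε T s hs
  exact ⟨H.length_le_of_forall_step hε T s hs, H.isApproxEquilibrium_of_not_step hε⟩
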